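/- Model (one smart target with scalar state). Fix $M\ge 1$ dynamics models with transition coefficients $F_m\in\mathbb R$ and process noise variances $Q_m>0$ ($1\le m\le M$), a measurement coefficient $H\in\mathbb R$, a measurement noise variance $R>0$, probability vectors $(u^{a,m})_{m=1}^M$ for $a\in\{0,1\}$, a weight $d\ge 0$, a measurement cost $h\ge 0$ and a discount factor $0<\beta<1$. The state is the tracking error variance $P\in(0,\infty)$; the action is $a=1$ (track) or $a=0$ (do not track). With $\bar P^m=F_m^2P+Q_m$, the next state is $\phi^0(P)=\sum_m u^{0,m}\bar P^m$ under $a=0$ and $$\phi^1(P)=\sum_m u^{1,m}(1-K^mH)\bar P^m,\qquad K^m=\frac{\bar P^mH}{H^2\bar P^m+R},$$ under $a=1$. The immediate cost is $C(P,a)=dP+ha$. For a policy $\pi$ and initial state $P$ let $$F(P,\pi)=\mathrm E^\pi_P\Big[\sum_{t\ge0}\beta^tC(P_t,a_t)\Big]\in[0,\infty],\qquad G(P,\pi)=\mathrm E^\pi_P\Big[\sum_{t\ge0}\beta^ta_t\Big].$$ For $\lambda\in\mathbb R$ the $\lambda$-subproblem is to minimize $F(P,\pi)+\lambda G(P,\pi)$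 over the stationary (possibly randomized) policies $\pi$. Write $\langle a,\pi\rangle$ for the policy that takes action $a$ at time $0$ and follows $\pi$ from time $1$ on. Action $a$ is optimal in state $P$ if, for some stationary $\pi$, the policy $\langle a,\pi\rangle$ attains the minimum from $P$. The subproblem is *indexable* if there is a function $\lambda^*:(0,\infty)\to\mathbb R$, its *Whittle index*, such that for all $\lambda\in\mathbb R$ and $P>0$: action $1$ is optimal in $P$ for the $\lambda$-subproblem if and only if $\lambda\le\lambda^*(P)$, and action $0$ is optimal if and only if $\lambda\ge\lambda^*(P)$. For $z\in[-\infty,\infty]$ the $z$-threshold policy tracks exactly when $P>z$; write $F(P,z)$, $G(P,z)$ for its metrics. Let $$f(P,z)=F(P,\langle0,z\rangle)-F(P,\langle1,z\rangle),\quad g(P,z)=G(P,\langle1,z\rangle)-G(P,\langle0,z\rangle),\quad \mathrm{mp}^*(P)=\frac{f(P,P)}{g(P,P)}.$$ The subproblem is *PCL-indexable* if $F(P,z)<\infty$ for all $P>0$ and $z\in\mathbb R$, and - (PCLI1) $g(P,z)>0$ for every $P>0$ and $z\in[-\infty,\infty]$; - (PCLI2) $\mathrm{mp}^*$ is monotone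 non-decreasing, continuous and bounded below on $(0,\infty)$; - (PCLI3) for every $P>0$ and all $-\infty<z_1<z_2<\infty$, as a Lebesgue–Stieltjes integral, $$F(P,z_1)-F(P,z_2)=\int_{(z_1,z_2]}\mathrm{mp}^*(z)\,G(P,dz).$$ **Corollary 1.** If the subproblem is PCL-indexable, then it is indexable, and its Whittle index is $\mathrm{mp}^*(P)$. -/

import Mathlib

open MeasureTheory Set
open scoped ENNReal

/-- Parameters of one smart target with scalar kinematic state and `M` dynamics models.
Actions are coded by `Bool`: `true` means that the target is tracked (`a = 1`),
`false` that it is not tracked (`a = 0`). -/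
structure SmartTarget (M : ℕ) where
  /-- state transition coefficient of each dynamics model -/
  trans : Fin M → ℝ
  /-- process noise variance of each dynamics model -/
  noiseVar : Fin M → ℝ
  /-- measurement coefficient -/
  H : ℝ
  /-- measurement noise variance -/
  R : ℝ
  /-- `u a m`: probability that the dynamics model drawn after action `a` is `m` -/
  u : Bool → Fin M → ℝ
  /-- weight of the tracking error variance in the cost -/
  d : ℝ
  /-- measurement cost -/
  h : ℝ
  /-- discount factor -/
  β : ℝ
  noiseVar_pos : ∀ m, 0 < noiseVar m
  R_pos : 0 < R
  u_nonneg : ∀ a m, 0 ≤ u a m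
  u_sum : ∀ a, ∑ m, u a m = 1
  d_nonneg : 0 ≤ d
  h_nonneg : 0 ≤ h
  β_pos : 0 < β
  β_lt_one : β < 1

/-- The numerical value of an action. -/
def actionValue (a : Bool) : ℝ := if a then 1 else 0

/-- A (possibly randomized) Markov policy: `prob t P` is the probability of choosing the active
action at time `t` when the tracking error variance is `P`. -/
structure TrackingPolicy where
  prob : ℕ → ℝ → unitInterval
  measurable_prob : ∀ t, Measurable (prob t)

namespace TrackingPolicy

/-- Stationary policies: the choice depends on the current state only. -/
def IsStationary (π : TrackingPolicy) : Prop := ∀ s t, π.prob s = π.prob t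

open Classical in
/-- The `z`-threshold policy, `z ∈ [-∞, ∞]`: track if and only if `P > z`. -/
noncomputable def threshold (z : EReal) : TrackingPolicy where
  prob _ P := if z < (P : EReal) then 1 else 0
  measurable_prob _ :=
    Measurable.ite (measurableSet_lt measurable_const measurable_coe_real_ereal)
      measurable_const measurable_const

/-- The policy `⟨a, π⟩`: take action `a` at time `0` and follow `π` from time `1` onwards. -/
noncomputable def startWith (a : Bool) (π : TrackingPolicy) : TrackingPolicy where
  prob
    | 0 => fun _ => if a then 1 else 0
    | t + 1 => π.prob t
  measurable_prob
    | 0 => measurable_const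
    | t + 1 => π.measurable_prob t

open Classical in
/-- Action chosen at time `t` in state `P` when the randomization device shows `s`; for `s` uniform
on `[0, 1]`, the active action is chosen with probability `π.prob t P`. -/
noncomputable def act (π : TrackingPolicy) (t : ℕ) (P : ℝ) (s : unitInterval) : Bool :=
  decide (s < π.prob t P)

end TrackingPolicy

/-- Law of the sequence of independent uniform variables on `[0, 1]` that drives the
randomization of the policies. -/
noncomputable def seedLaw : Measure (ℕ → unitInterval) :=
  Measure.infinitePi fun _ => (volume : Measure unitInterval)

/-- `A` is locally of bounded variation and right-continuous (a difference of two Stieltjes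
functions), `φ` is integrable over bounded intervals for the corresponding signed measure, and
`I z₁ z₂` is the Lebesgue-Stieltjes integral of `φ` against `dA` over `(z₁, z₂]`.
The value of the integral does not depend on the decomposition. -/
def HasLebesgueStieltjesIntegral (A φ : ℝ → ℝ) (I : ℝ → ℝ → ℝ) : Prop :=
  ∃ γ₁ γ₂ : StieltjesFunction ℝ, (∀ z, A z = γ₁ z - γ₂ z) ∧
    ∀ z₁ z₂, z₁ < z₂ →
      IntegrableOn φ (Ioc z₁ z₂) γ₁.measure ∧ IntegrableOn φ (Ioc z₁ z₂) γ₂.measure ∧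
      I z₁ z₂ = (∫ z in Ioc z₁ z₂, φ z ∂γ₁.measure) - ∫ z in Ioc z₁ z₂, φ z ∂γ₂.measure

namespace SmartTarget

variable {M : ℕ} (T : SmartTarget M)

/-- Predicted error variance under model `m`. -/
def predVar (m : Fin M) (P : ℝ) : ℝ := T.trans m * P * T.trans m + T.noiseVar m

/-- Kalman gain under model `m`. -/
noncomputable def gain (m : Fin M) (P : ℝ) : ℝ :=
  T.predVar m P * T.H * (T.H * T.predVar m P * T.H + T.R)⁻¹

/-- Updated error variance under model `m`, after a measurement. -/
noncomputable def updVar (m : Fin M) (P : ℝ) : ℝ := (1 - T.gain m P * T.H) * T.predVar m P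

/-- The tracking error variance update `φ ^ a`. -/
noncomputable def φ : Bool → ℝ → ℝ
  | true, P => ∑ m, T.u true m * T.updVar m P
  | false, P => ∑ m, T.u false m * T.predVar m P

theorem predVar_pos (m : Fin M) {P : ℝ} (hP : 0 < P) : 0 < T.predVar m P := by
  have h1 := T.noiseVar_pos m
  have h2 : 0 ≤ T.trans m * P * T.trans m := by nlinarith [mul_self_nonneg (T.trans m)]
  unfold predVar
  linarith

theorem updVar_pos (m : Fin M) {P : ℝ} (hP : 0 < P) : 0 < T.updVar m P := by
  have h1 := T.predVar_pos m hP
  have h2 := T.R_pos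
  have h3 : 0 < T.H * T.predVar m P * T.H + T.R := by nlinarith [mul_self_nonneg T.H]
  have h4 : T.updVar m P = T.R * T.predVar m P / (T.H * T.predVar m P * T.H + T.R) := by
    unfold updVar gain
    field_simp
    ring
  rw [h4]
  positivity

/-- The update maps the state space `(0, ∞)` into itself. -/
theorem φ_pos (a : Bool) {P : ℝ} (hP : 0 < P) : 0 < T.φ a P := by
  have key : ∀ v : Fin M → ℝ, (∀ m, 0 < v m) → 0 < ∑ m, T.u a m * v m := by
    intro v hv
    have hne : ∃ m, T.u a m ≠ 0 := by
      by_contra hcon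
      push Not at hcon
      have := T.u_sum a
      simp [hcon] at this
    obtain ⟨m, hm⟩ := hne
    refine Finset.sum_pos' (fun i _ => mul_nonneg (T.u_nonneg a i) (hv i).le)
      ⟨m, Finset.mem_univ m, mul_pos (lt_of_le_of_ne (T.u_nonneg a m) (Ne.symm hm)) (hv m)⟩
  cases a
  · exact key _ fun m => T.predVar_pos m hP
  · exact key _ fun m => T.updVar_pos m hP

/-- Immediate cost. -/
def cost (P : ℝ) (a : Bool) : ℝ := T.d * P + T.h * actionValue a

/-- State at each time, from the initial state `P`, under policy `π`, as a function of the
randomization `ω`. -/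
noncomputable def state (π : TrackingPolicy) (P : ℝ) (ω : ℕ → unitInterval) : ℕ → ℝ
  | 0 => P
  | t + 1 => T.φ (π.act t (state π P ω t) (ω t)) (state π P ω t)

/-- Action at each time. -/
noncomputable def action (π : TrackingPolicy) (P : ℝ) (ω : ℕ → unitInterval) (t : ℕ) : Bool :=
  π.act t (T.state π P ω t) (ω t)

/-- Expected total discounted value of a nonnegative stage cost `c`, in `[0, ∞]`. -/
noncomputable def discounted (c : ℝ → Bool → ℝ) (P : ℝ) (π : TrackingPolicy) : ℝ≥0∞ :=
  ∫⁻ ω, ∑' t : ℕ, ENNReal.ofReal (T.β ^ t * c (T.state π P ω t) (T.action π P ω t)) ∂seedLaw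

/-- Cost metric `F(P, π) ∈ [0, ∞]`. -/
noncomputable def costMetric (P : ℝ) (π : TrackingPolicy) : ℝ≥0∞ := T.discounted T.cost P π

/-- Work metric `G(P, π)`; it lies in `[0, 1 / (1 - β)]`. -/
noncomputable def workMetric (P : ℝ) (π : TrackingPolicy) : ℝ :=
  (T.discounted (fun _ a => actionValue a) P π).toReal

/-- Objective `F(P, π) + l G(P, π)` of the subproblem with multiplier `l`, in `(-∞, ∞]`. -/
noncomputable def objective (l P : ℝ) (π : TrackingPolicy) : EReal :=
  (T.costMetric P π : EReal) + ((l * T.workMetric P π : ℝ) : EReal)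

/-- In the subproblem with multiplier `l`, taking action `a` in state `P` is optimal: for some
stationary policy `π`, taking `a` now and following `π` afterwards attains the minimum of the
objective over the stationary policies. -/
def ActionOptimal (l P : ℝ) (a : Bool) : Prop :=
  ∃ π : TrackingPolicy, π.IsStationary ∧ ∀ π' : TrackingPolicy, π'.IsStationary →
    T.objective l P (TrackingPolicy.startWith a π) ≤ T.objective l P π'

/-- `ind` is a Whittle index of the subproblem. -/
def IsWhittleIndex (ind : ℝ → ℝ) : Prop :=
  ∀ l P : ℝ, 0 < P →
    (T.ActionOptimal l P true ↔ l ≤ ind P) ∧ (T.ActionOptimal l P false ↔ ind P ≤ l)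

/-- The subproblem is indexable. -/
def Indexable : Prop := ∃ ind : ℝ → ℝ, T.IsWhittleIndex ind

/-- Marginal cost metric `f(P, z) = F(P, ⟨0, z⟩) - F(P, ⟨1, z⟩)`. -/
noncomputable def marginalCost (P : ℝ) (z : EReal) : ℝ :=
  (T.costMetric P (.startWith false (.threshold z))).toReal -
    (T.costMetric P (.startWith true (.threshold z))).toReal

/-- Marginal work metric `g(P, z) = G(P, ⟨1, z⟩) - G(P, ⟨0, z⟩)`. -/
noncomputable def marginalWork (P : ℝ) (z : EReal) : ℝ :=
  T.workMetric P (.startWith true (.threshold z)) -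
    T.workMetric P (.startWith false (.threshold z))

/-- Marginal productivity index `mp*(P) = f(P, P) / g(P, P)`. -/
noncomputable def mpIndex (P : ℝ) : ℝ := T.marginalCost P P / T.marginalWork P P

/-- PCL-indexability with respect to threshold policies. -/
structure PCLIndexable : Prop where
  /-- the cost metrics of the policies with finite threshold are real numbers -/
  cost_finite : ∀ P : ℝ, 0 < P → ∀ z : ℝ, T.costMetric P (.threshold z) < ∞
  /-- positive marginal work -/
  work_pos : ∀ P : ℝ, 0 < P → ∀ z : EReal, 0 < T.marginalWork P z
  mp_mono : MonotoneOn T.mpIndex (Ioi 0)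
  mp_cont : ContinuousOn T.mpIndex (Ioi 0)
  mp_bddBelow : BddBelow (T.mpIndex '' Ioi 0)
  /-- `F(P, z₁) - F(P, z₂) = ∫_{(z₁, z₂]} mp*(z) G(P, dz)` for `z₁ < z₂`. The set of `z ≤ 0` does
  not contribute: `G(P, z)` is constant there. -/
  cost_eq_integral : ∀ P : ℝ, 0 < P →
    HasLebesgueStieltjesIntegral (fun z : ℝ => T.workMetric P (.threshold z)) T.mpIndex
      fun z₁ z₂ => (T.costMetric P (.threshold z₁)).toReal -
        (T.costMetric P (.threshold z₂)).toReal

end SmartTarget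

/-!
For each price `l` there is a threshold policy that solves the Bellman equation of the
`l`-subproblem, and the sign of `mp*(P) - l` is the sign of the advantage
`f(P, z) - l g(P, z)` of tracking once in state `P` before following that policy.

*Sign of the advantage.* Fix `P` and let `Φ(z) = f(P, z) - mp*(z) g(P, z)`, which vanishes at
`z = P` by the definition of `mp*`. Since `f(P, ·)` and `g(P, ·)` are affine in the metrics at the
two successors of `P`, the integral identity for `F` gives `df = -mp* dg` up to the constants, so
that `dΦ = -g dmp*` by the continuity of `mp*`. As `g > 0`, `Φ` is nonincreasing, strictly so where
`mp*` increases (`gap_antitone`). The identity enters only through the bounds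
`PCLIndexable.thresholdCost_sub_bounds`, which rest on `G(P, ·)` being nonincreasing
(`thresholdWork_antitone`). Extending `mp*` to `z = 0` by its infimum makes the argument cover the
policy that always tracks.

*Choice of the threshold* (`PCLIndexable.exists_optimalThreshold`). If `l = mp*(z)` for some
`z ≥ 0`, take `z`. If `l` lies below the index, take `0`. If `l` lies above the index, take `∞`: the
index is then bounded, which forces `F(P, ∞) < ∞` and `F(P, z) → F(P, ∞)`, and the sign passes to
the limit.

*Verification* (`le_objective_of_bellman`). Costs are unbounded, so a solution `V` of the Bellman
equation has to be controlled along arbitrary policies. The optimal thresholds have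
`V(P) ≤ K + K d P`, because `F(P, 0)` grows at most linearly: the tracked update satisfies
`φ¹(k P) ≤ k φ¹(P)` for `k ≥ 1`. Along a policy of finite cost `∑ β^t E[d P_t] < ∞`, so the terminal
terms `β^n E[V(P_n)]` do not contribute in the limit. Randomized policies are handled by
conditioning on the first action (`total_first_step`).
-/

/-! ### First-step analysis of randomized policies -/

/-- Prepend a seed to a sequence of seeds. -/
def consSeed (s : unitInterval) (ω : ℕ → unitInterval) : ℕ → unitInterval
  | 0 => s
  | t + 1 => ω t

theorem measurable_consSeed :
    Measurable fun x : unitInterval × (ℕ → unitInterval) => consSeed x.1 x.2 := by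
  refine measurable_pi_lambda _ fun t => ?_
  cases t with
  | zero => exact measurable_fst
  | succ t => exact (measurable_pi_apply t).comp measurable_snd

instance : IsProbabilityMeasure seedLaw := by
  unfold seedLaw; infer_instance

/-- The seed at time `0` is uniform and independent of the later ones, which again follow
`seedLaw`. -/
theorem map_consSeed_seedLaw :
    ((volume : Measure unitInterval).prod seedLaw).map (fun x => consSeed x.1 x.2) = seedLaw := by
  refine Measure.eq_infinitePi _ fun s t ht => ?_
  have hinj : InjOn Nat.succ (Nat.succ ⁻¹' (s : Set ℕ)) := Nat.succ_injective.injOn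
  have hpre : (fun x : unitInterval × (ℕ → unitInterval) => consSeed x.1 x.2) ⁻¹' (s : Set ℕ).pi t =
      (if 0 ∈ s then t 0 else univ) ×ˢ
        ((s.preimage Nat.succ hinj : Finset ℕ) : Set ℕ).pi fun i => t (i + 1) := by
    ext x
    simp only [mem_preimage, Set.mem_pi, SetLike.mem_coe, Finset.coe_preimage, mem_prod]
    constructor
    · intro h
      refine ⟨?_, fun i hi => h _ hi⟩
      split_ifs with h0
      · exact h 0 h0
      · trivial
    · rintro ⟨h0, h1⟩ i hi
      cases i with
      | zero => rw [if_pos hi] at h0; exact h0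
      | succ i => exact h1 i hi
  rw [Measure.map_apply measurable_consSeed
    (MeasurableSet.pi s.countable_toSet fun i _ => ht i), hpre, Measure.prod_prod, seedLaw,
    Measure.infinitePi_pi _ fun i _ => ht (i + 1)]
  have h1 : ∏ i ∈ s.preimage Nat.succ hinj, (volume : Measure unitInterval) (t (i + 1)) =
      ∏ i ∈ s.erase 0, (volume : Measure unitInterval) (t i) := by
    classical
    rw [Finset.prod_preimage' Nat.succ s hinj fun i => (volume : Measure unitInterval) (t i)]
    congr 1
    ext i
    cases i <;> simp
  rw [h1]
  split_ifs with h0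
  · exact Finset.mul_prod_erase s (fun i => (volume : Measure unitInterval) (t i)) h0
  · rw [measure_univ, one_mul, Finset.erase_eq_of_notMem h0]

namespace TrackingPolicy

/-- The policy that prescribes at time `t` what `π` prescribes at time `t + 1`. -/
def shift (π : TrackingPolicy) : TrackingPolicy where
  prob t := π.prob (t + 1)
  measurable_prob t := π.measurable_prob (t + 1)

theorem shift_startWith (a : Bool) (π : TrackingPolicy) : (startWith a π).shift = π := rfl

theorem IsStationary.shift_eq {π : TrackingPolicy} (h : π.IsStationary) : π.shift = π := by
  cases π
  simp only [shift, TrackingPolicy.mk.injEq]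
  funext t
  exact h _ _

theorem isStationary_threshold (z : EReal) : (threshold z).IsStationary := fun _ _ => rfl

theorem measurable_act (π : TrackingPolicy) (t : ℕ) :
    Measurable fun x : ℝ × unitInterval => π.act t x.1 x.2 := by
  unfold act
  refine measurable_to_bool ?_
  have h1 : (fun x : ℝ × unitInterval => decide (x.2 < π.prob t x.1)) ⁻¹' {true} =
      {x | x.2 < π.prob t x.1} := by
    ext x
    simp
  rw [h1]
  exact measurableSet_lt measurable_snd ((π.measurable_prob t).comp measurable_fst)

end TrackingPolicy

namespace SmartTarget

variable {M : ℕ} (T : SmartTarget M)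

theorem measurable_φ (a : Bool) : Measurable (T.φ a) := by
  cases a
  · unfold φ predVar
    fun_prop
  · unfold φ updVar gain predVar
    fun_prop

theorem measurable_state (π : TrackingPolicy) (P : ℝ) (t : ℕ) :
    Measurable fun ω => T.state π P ω t := by
  induction t with
  | zero => exact measurable_const
  | succ t ih =>
    have h1 : Measurable fun x : Bool × ℝ => T.φ x.1 x.2 :=
      measurable_from_prod_countable_right T.measurable_φ
    exact h1.comp (((π.measurable_act t).comp (ih.prodMk (measurable_pi_apply t))).prodMk ih)

theorem measurable_action (π : TrackingPolicy) (P : ℝ) (t : ℕ) :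
    Measurable fun ω => T.action π P ω t :=
  (π.measurable_act t).comp ((T.measurable_state π P t).prodMk (measurable_pi_apply t))

theorem measurable_stage (π : TrackingPolicy) (P : ℝ) (t : ℕ) {c : ℝ → Bool → ℝ≥0∞}
    (hc : ∀ a, Measurable fun P => c P a) :
    Measurable fun ω => c (T.state π P ω t) (T.action π P ω t) := by
  have h1 : Measurable fun x : Bool × ℝ => c x.2 x.1 := measurable_from_prod_countable_right hc
  exact h1.comp ((T.measurable_action π P t).prodMk (T.measurable_state π P t))

theorem state_pos (π : TrackingPolicy) {P : ℝ} (hP : 0 < P) (ω : ℕ → unitInterval) (t : ℕ) :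
    0 < T.state π P ω t := by
  induction t with
  | zero => exact hP
  | succ t ih => exact T.φ_pos _ ih

theorem state_consSeed (π : TrackingPolicy) (P : ℝ) (s : unitInterval) (ω : ℕ → unitInterval)
    (t : ℕ) :
    T.state π P (consSeed s ω) (t + 1) = T.state π.shift (T.φ (π.act 0 P s) P) ω t := by
  induction t with
  | zero => rfl
  | succ t ih =>
    rw [state, ih]
    rfl

theorem action_consSeed (π : TrackingPolicy) (P : ℝ) (s : unitInterval) (ω : ℕ → unitInterval)
    (t : ℕ) :
    T.action π P (consSeed s ω) (t + 1) = T.action π.shift (T.φ (π.act 0 P s) P) ω t := by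
  unfold action
  rw [state_consSeed]
  rfl

/-- Expected total of the stage costs `c t`, with the discounting left to `c`. -/
noncomputable def total (c : ℕ → ℝ → Bool → ℝ≥0∞) (P : ℝ) (π : TrackingPolicy) : ℝ≥0∞ :=
  ∫⁻ ω, ∑' t : ℕ, c t (T.state π P ω t) (T.action π P ω t) ∂seedLaw

/-- The discounted stage cost at time `t`. -/
noncomputable def stage (c : ℝ → Bool → ℝ) (t : ℕ) (P : ℝ) (a : Bool) : ℝ≥0∞ :=
  ENNReal.ofReal (T.β ^ t * c P a)

theorem discounted_eq_total (c : ℝ → Bool → ℝ) (P : ℝ) (π : TrackingPolicy) :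
    T.discounted c P π = T.total (T.stage c) P π := rfl

/-- Conditioning on the first action. -/
theorem total_first_step {c : ℕ → ℝ → Bool → ℝ≥0∞} (hc : ∀ t a, Measurable fun P => c t P a)
    (P : ℝ) (π : TrackingPolicy) :
    T.total c P π =
      ENNReal.ofReal (π.prob 0 P) *
          (c 0 P true + T.total (fun t => c (t + 1)) (T.φ true P) π.shift) +
        ENNReal.ofReal (1 - π.prob 0 P) *
          (c 0 P false + T.total (fun t => c (t + 1)) (T.φ false P) π.shift) := by
  have hmeas : ∀ (c : ℕ → ℝ → Bool → ℝ≥0∞), (∀ t a, Measurable fun P => c t P a) →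
      ∀ (P : ℝ) (π : TrackingPolicy), Measurable fun ω => ∑' t : ℕ,
        c t (T.state π P ω t) (T.action π P ω t) := fun c hc P π =>
    Measurable.tsum fun t => T.measurable_stage π P t (hc t)
  set B : Bool → ℝ≥0∞ := fun a => c 0 P a + T.total (fun t => c (t + 1)) (T.φ a P) π.shift
  have h1 : T.total c P π = ∫⁻ s : unitInterval, B (π.act 0 P s) := by
    unfold total
    conv_lhs => rw [← map_consSeed_seedLaw]
    rw [lintegral_map (hmeas c hc P π) measurable_consSeed,
      lintegral_prod (fun x : unitInterval × (ℕ → unitInterval) => ∑' t : ℕ,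
          c t (T.state π P (consSeed x.1 x.2) t) (T.action π P (consSeed x.1 x.2) t))
        ((hmeas c hc P π).comp measurable_consSeed).aemeasurable]
    refine lintegral_congr fun s => ?_
    have h2 : ∀ ω, ∑' t : ℕ, c t (T.state π P (consSeed s ω) t) (T.action π P (consSeed s ω) t) =
        c 0 P (π.act 0 P s) + ∑' t : ℕ, c (t + 1) (T.state π.shift (T.φ (π.act 0 P s) P) ω t)
          (T.action π.shift (T.φ (π.act 0 P s) P) ω t) := by
      intro ω
      rw [tsum_eq_zero_add' ENNReal.summable]
      simp only [state_consSeed, action_consSeed]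
      rfl
    simp only [h2]
    rw [lintegral_add_left measurable_const]
    simp [B, total]
  have hset : MeasurableSet (Iio (π.prob 0 P)) := measurableSet_Iio
  rw [h1, ← lintegral_add_compl _ hset]
  have h3 : ∫⁻ s in Iio (π.prob 0 P), B (π.act 0 P s) =
      ∫⁻ _ in Iio (π.prob 0 P), B true := by
    refine setLIntegral_congr_fun hset fun s hs => ?_
    have : π.act 0 P s = true := by simpa [TrackingPolicy.act] using hs
    simp only [this]
  have h4 : ∫⁻ s in (Iio (π.prob 0 P))ᶜ, B (π.act 0 P s) =
      ∫⁻ _ in (Iio (π.prob 0 P))ᶜ, B false := by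
    refine setLIntegral_congr_fun hset.compl fun s hs => ?_
    have : π.act 0 P s = false := by simpa [TrackingPolicy.act] using hs
    simp only [this]
  rw [h3, h4, setLIntegral_const, setLIntegral_const, compl_Iio, unitInterval.volume_Iio,
    unitInterval.volume_Ici, mul_comm, mul_comm (B false)]

theorem total_const_mul (c : ℕ → ℝ → Bool → ℝ≥0∞) {k : ℝ≥0∞} (hk : k ≠ ∞) (P : ℝ)
    (π : TrackingPolicy) :
    T.total (fun t P a => k * c t P a) P π = k * T.total c P π := by
  unfold total
  simp only [ENNReal.tsum_mul_left]
  exact lintegral_const_mul' _ _ hk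

theorem total_add {c₁ : ℕ → ℝ → Bool → ℝ≥0∞} (h₁ : ∀ t a, Measurable fun P => c₁ t P a)
    (c₂ : ℕ → ℝ → Bool → ℝ≥0∞) (P : ℝ) (π : TrackingPolicy) :
    T.total (fun t P a => c₁ t P a + c₂ t P a) P π = T.total c₁ P π + T.total c₂ P π := by
  unfold total
  simp only [ENNReal.tsum_add]
  exact lintegral_add_left (Measurable.tsum fun t => T.measurable_stage π P t (h₁ t)) _

theorem total_le_total {c₁ c₂ : ℕ → ℝ → Bool → ℝ≥0∞} {P : ℝ} (hP : 0 < P) (π : TrackingPolicy)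
    (h : ∀ t, ∀ P, 0 < P → ∀ a, c₁ t P a ≤ c₂ t P a) : T.total c₁ P π ≤ T.total c₂ P π :=
  lintegral_mono fun ω => ENNReal.tsum_le_tsum fun t => h t _ (T.state_pos π hP ω t) _

theorem total_congr {c₁ c₂ : ℕ → ℝ → Bool → ℝ≥0∞} {P : ℝ} (hP : 0 < P) (π : TrackingPolicy)
    (h : ∀ t, ∀ P, 0 < P → ∀ a, c₁ t P a = c₂ t P a) : T.total c₁ P π = T.total c₂ P π :=
  le_antisymm (T.total_le_total hP π fun t P hP a => (h t P hP a).le)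
    (T.total_le_total hP π fun t P hP a => (h t P hP a).ge)

theorem measurable_stage_left {c : ℝ → Bool → ℝ} (hc : ∀ a, Measurable fun P => c P a) (t : ℕ)
    (a : Bool) : Measurable fun P => T.stage c t P a :=
  ((hc a).const_mul _).ennreal_ofReal

theorem stage_succ (c : ℝ → Bool → ℝ) (t : ℕ) (P : ℝ) (a : Bool) :
    T.stage c (t + 1) P a = ENNReal.ofReal T.β * T.stage c t P a := by
  unfold stage
  rw [← ENNReal.ofReal_mul T.β_pos.le]
  ring_nf

theorem discounted_first_step {c : ℝ → Bool → ℝ} (hc : ∀ a, Measurable fun P => c P a)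
    (P : ℝ) (π : TrackingPolicy) :
    T.discounted c P π =
      ENNReal.ofReal (π.prob 0 P) * (ENNReal.ofReal (c P true) +
          ENNReal.ofReal T.β * T.discounted c (T.φ true P) π.shift) +
        ENNReal.ofReal (1 - π.prob 0 P) * (ENNReal.ofReal (c P false) +
          ENNReal.ofReal T.β * T.discounted c (T.φ false P) π.shift) := by
  have h := fun a => T.total_const_mul (T.stage c) (k := ENNReal.ofReal T.β)
    ENNReal.ofReal_ne_top (T.φ a P) π.shift
  simp only [discounted_eq_total]
  rw [T.total_first_step (T.measurable_stage_left hc)]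
  have h2 : (fun t => T.stage c (t + 1)) = fun t P a => ENNReal.ofReal T.β * T.stage c t P a := by
    funext t P a
    exact T.stage_succ c t P a
  rw [h2, h, h]
  simp [stage]

theorem discounted_startWith {c : ℝ → Bool → ℝ} (hc : ∀ a, Measurable fun P => c P a)
    (P : ℝ) (a : Bool) (π : TrackingPolicy) :
    T.discounted c P (.startWith a π) =
      ENNReal.ofReal (c P a) + ENNReal.ofReal T.β * T.discounted c (T.φ a P) π := by
  rw [T.discounted_first_step hc, TrackingPolicy.shift_startWith]
  cases a <;> simp [TrackingPolicy.startWith]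

open Classical in
theorem discounted_threshold {c : ℝ → Bool → ℝ} (hc : ∀ a, Measurable fun P => c P a)
    (P : ℝ) (z : EReal) :
    T.discounted c P (.threshold z) =
      T.discounted c P (.startWith (decide (z < (P : EReal))) (.threshold z)) := by
  rw [T.discounted_startWith hc, T.discounted_first_step hc,
    (TrackingPolicy.isStationary_threshold z).shift_eq]
  by_cases h : z < (P : EReal) <;> simp [TrackingPolicy.threshold, h]

theorem measurable_cost (a : Bool) : Measurable fun P => T.cost P a := by
  unfold cost; fun_prop

theorem cost_nonneg {P : ℝ} (hP : 0 < P) (a : Bool) : 0 ≤ T.cost P a := by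
  have h1 := mul_nonneg T.d_nonneg hP.le
  have h2 := T.h_nonneg
  cases a <;> simp only [cost, actionValue] <;> simp <;> linarith

theorem actionValue_nonneg (a : Bool) : 0 ≤ actionValue a := by
  cases a <;> simp [actionValue]

theorem actionValue_le_one (a : Bool) : actionValue a ≤ 1 := by
  cases a <;> simp [actionValue]

theorem discounted_const {k : ℝ} (hk : 0 ≤ k) (P : ℝ) (π : TrackingPolicy) :
    T.discounted (fun _ _ => k) P π = ENNReal.ofReal (k / (1 - T.β)) := by
  have hs := summable_geometric_of_lt_one T.β_pos.le T.β_lt_one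
  unfold discounted
  rw [lintegral_const, measure_univ, mul_one, ← ENNReal.ofReal_tsum_of_nonneg
    (fun t => mul_nonneg (pow_nonneg T.β_pos.le _) hk) (hs.mul_right k), tsum_mul_right,
    tsum_geometric_of_lt_one T.β_pos.le T.β_lt_one, inv_mul_eq_div]

theorem discounted_work_le (P : ℝ) (π : TrackingPolicy) :
    T.discounted (fun _ a => actionValue a) P π ≤ ENNReal.ofReal (1 / (1 - T.β)) := by
  rw [← T.discounted_const zero_le_one P π]
  refine lintegral_mono fun ω => ENNReal.tsum_le_tsum fun t => ENNReal.ofReal_le_ofReal ?_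
  exact mul_le_mul_of_nonneg_left (actionValue_le_one _) (pow_nonneg T.β_pos.le _)

theorem discounted_work_ne_top (P : ℝ) (π : TrackingPolicy) :
    T.discounted (fun _ a => actionValue a) P π ≠ ∞ :=
  ((T.discounted_work_le P π).trans_lt ENNReal.ofReal_lt_top).ne

theorem workMetric_nonneg (P : ℝ) (π : TrackingPolicy) : 0 ≤ T.workMetric P π :=
  ENNReal.toReal_nonneg

theorem workMetric_le (P : ℝ) (π : TrackingPolicy) : T.workMetric P π ≤ 1 / (1 - T.β) :=
  ENNReal.toReal_le_of_le_ofReal (div_nonneg zero_le_one (by linarith [T.β_lt_one]))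
    (T.discounted_work_le P π)

theorem workMetric_startWith (P : ℝ) (a : Bool) (π : TrackingPolicy) :
    T.workMetric P (.startWith a π) = actionValue a + T.β * T.workMetric (T.φ a P) π := by
  unfold workMetric
  rw [T.discounted_startWith (c := fun _ a => actionValue a) (fun _ => measurable_const), ENNReal.toReal_add
    ENNReal.ofReal_ne_top (ENNReal.mul_ne_top ENNReal.ofReal_ne_top (T.discounted_work_ne_top _ _)),
    ENNReal.toReal_mul, ENNReal.toReal_ofReal (actionValue_nonneg a),
    ENNReal.toReal_ofReal T.β_pos.le]

open Classical in
theorem workMetric_threshold (P : ℝ) (z : EReal) :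
    T.workMetric P (.threshold z) =
      T.workMetric P (.startWith (decide (z < (P : EReal))) (.threshold z)) := by
  unfold workMetric
  rw [T.discounted_threshold (c := fun _ a => actionValue a) (fun _ => measurable_const)]

theorem costMetric_startWith (P : ℝ) (a : Bool) (π : TrackingPolicy) :
    T.costMetric P (.startWith a π) =
      ENNReal.ofReal (T.cost P a) + ENNReal.ofReal T.β * T.costMetric (T.φ a P) π :=
  T.discounted_startWith T.measurable_cost P a π

open Classical in
theorem costMetric_threshold (P : ℝ) (z : EReal) :
    T.costMetric P (.threshold z) =
      T.costMetric P (.startWith (decide (z < (P : EReal))) (.threshold z)) :=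
  T.discounted_threshold T.measurable_cost P z

theorem costMetric_startWith_ne_top_iff (P : ℝ) (a : Bool) (π : TrackingPolicy) :
    T.costMetric P (.startWith a π) ≠ ∞ ↔ T.costMetric (T.φ a P) π ≠ ∞ := by
  have : ENNReal.ofReal T.β ≠ 0 := by simpa using T.β_pos
  rw [costMetric_startWith]
  simp [ENNReal.mul_eq_top, this]

theorem costMetric_startWith_toReal {P : ℝ} (hP : 0 < P) (a : Bool) {π : TrackingPolicy}
    (h : T.costMetric (T.φ a P) π ≠ ∞) :
    (T.costMetric P (.startWith a π)).toReal =
      T.cost P a + T.β * (T.costMetric (T.φ a P) π).toReal := by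
  rw [costMetric_startWith, ENNReal.toReal_add ENNReal.ofReal_ne_top
    (ENNReal.mul_ne_top ENNReal.ofReal_ne_top h), ENNReal.toReal_mul,
    ENNReal.toReal_ofReal (T.cost_nonneg hP a), ENNReal.toReal_ofReal T.β_pos.le]

end SmartTarget

/-! ### Verification: subsolutions of the Bellman equation bound the objective -/

namespace SmartTarget

variable {M : ℕ} (T : SmartTarget M)

theorem discounted_add {c₁ c₂ : ℝ → Bool → ℝ} (hm : ∀ a, Measurable fun P => c₁ P a)
    (h₁ : ∀ P, 0 < P → ∀ a, 0 ≤ c₁ P a) (h₂ : ∀ P, 0 < P → ∀ a, 0 ≤ c₂ P a) {P : ℝ} (hP : 0 < P)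
    (π : TrackingPolicy) :
    T.discounted (fun P a => c₁ P a + c₂ P a) P π = T.discounted c₁ P π + T.discounted c₂ P π := by
  simp only [discounted_eq_total]
  rw [← T.total_add (T.measurable_stage_left hm)]
  refine T.total_congr hP π fun t P hP a => ?_
  have hβ := pow_nonneg T.β_pos.le t
  simp only [stage]
  rw [mul_add, ENNReal.ofReal_add (mul_nonneg hβ (h₁ P hP a)) (mul_nonneg hβ (h₂ P hP a))]

theorem discounted_const_mul {k : ℝ} (hk : 0 ≤ k) (c : ℝ → Bool → ℝ) (P : ℝ)
    (π : TrackingPolicy) :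
    T.discounted (fun P a => k * c P a) P π = ENNReal.ofReal k * T.discounted c P π := by
  simp only [discounted_eq_total]
  rw [← T.total_const_mul _ ENNReal.ofReal_ne_top]
  congr 1
  funext t P a
  simp only [stage]
  rw [← ENNReal.ofReal_mul hk]
  ring_nf

theorem discounted_mono {c₁ c₂ : ℝ → Bool → ℝ} {P : ℝ} (hP : 0 < P) (π : TrackingPolicy)
    (h : ∀ P, 0 < P → ∀ a, c₁ P a ≤ c₂ P a) : T.discounted c₁ P π ≤ T.discounted c₂ P π :=
  T.total_le_total hP π fun t P hP a => ENNReal.ofReal_le_ofReal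
    (mul_le_mul_of_nonneg_left (h P hP a) (pow_nonneg T.β_pos.le t))

/-- The stage costs `c` up to time `n - 1`, and a terminal cost `b` at time `n`. -/
noncomputable def horizonStage (c b : ℝ → Bool → ℝ) (n t : ℕ) (P : ℝ) (a : Bool) : ℝ≥0∞ :=
  if t < n then T.stage c t P a else if t = n then T.stage b t P a else 0

theorem horizonStage_succ (c b : ℝ → Bool → ℝ) (n t : ℕ) (P : ℝ) (a : Bool) :
    T.horizonStage c b (n + 1) (t + 1) P a =
      ENNReal.ofReal T.β * T.horizonStage c b n t P a := by
  unfold horizonStage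
  simp only [add_lt_add_iff_right, add_left_inj, stage_succ]
  split_ifs <;> simp

/-- Bellman's inequality iterated up to a finite horizon. -/
theorem le_total_horizonStage {c b : ℝ → Bool → ℝ} (hc : ∀ a, Measurable fun P => c P a)
    (hb : ∀ a, Measurable fun P => b P a) {U : ℝ → ℝ≥0∞}
    (hU : ∀ P, 0 < P → ∀ a, U P ≤ ENNReal.ofReal (c P a) + ENNReal.ofReal T.β * U (T.φ a P))
    (hUb : ∀ P, 0 < P → ∀ a, U P ≤ ENNReal.ofReal (b P a)) (n : ℕ) {P : ℝ} (hP : 0 < P)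
    (π : TrackingPolicy) : U P ≤ T.total (T.horizonStage c b n) P π := by
  have hmeas : ∀ n t a, Measurable fun P => T.horizonStage c b n t P a := by
    intro n t a
    unfold horizonStage
    split_ifs
    · exact T.measurable_stage_left hc t a
    · exact T.measurable_stage_left hb t a
    · exact measurable_const
  -- It suffices to bound `U P` by the value of either first action.
  have key : ∀ n P (π : TrackingPolicy), (∀ a, U P ≤ T.horizonStage c b n 0 P a +
      T.total (fun t => T.horizonStage c b n (t + 1)) (T.φ a P) π.shift) →
      U P ≤ T.total (T.horizonStage c b n) P π := by
    intro n P π h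
    rw [T.total_first_step (hmeas n)]
    have h1 : U P = ENNReal.ofReal (π.prob 0 P) * U P +
        ENNReal.ofReal (1 - π.prob 0 P) * U P := by
      rw [← add_mul, ← ENNReal.ofReal_add (π.prob 0 P).2.1 (by linarith [(π.prob 0 P).2.2])]
      simp
    conv_lhs => rw [h1]
    gcongr
    · exact h true
    · exact h false
  induction n generalizing P π with
  | zero =>
    refine key 0 P π fun a => le_add_right ?_
    simpa [horizonStage, stage] using hUb P hP a
  | succ n ih =>
    refine key (n + 1) P π fun a => (hU P hP a).trans ?_
    have h2 : (fun t => T.horizonStage c b (n + 1) (t + 1)) =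
        fun t P a => ENNReal.ofReal T.β * T.horizonStage c b n t P a := by
      funext t P a
      exact T.horizonStage_succ c b n t P a
    rw [h2, T.total_const_mul _ ENNReal.ofReal_ne_top]
    gcongr
    · simp [horizonStage, stage]
    · exact ih (T.φ_pos a hP) π.shift

/-- A function that lies below the right-hand side of the Bellman equation for both actions, and
below a function `b` of finite total discounted value, lies below the total discounted cost of
every policy: the terminal costs at the horizons `n` are the terms of a convergent series. -/
theorem le_discounted_of_bellman {c b : ℝ → Bool → ℝ} (hc : ∀ a, Measurable fun P => c P a)
    (hb : ∀ a, Measurable fun P => b P a) {U : ℝ → ℝ≥0∞}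
    (hU : ∀ P, 0 < P → ∀ a, U P ≤ ENNReal.ofReal (c P a) + ENNReal.ofReal T.β * U (T.φ a P))
    (hUb : ∀ P, 0 < P → ∀ a, U P ≤ ENNReal.ofReal (b P a)) {P : ℝ} (hP : 0 < P)
    (π : TrackingPolicy) (hfin : T.discounted b P π ≠ ∞) : U P ≤ T.discounted c P π := by
  set r : ℕ → ℝ≥0∞ := fun n => ∫⁻ ω, T.stage b n (T.state π P ω n) (T.action π P ω n) ∂seedLaw
  have hsum : ∑' n, r n = T.discounted b P π := by
    rw [← lintegral_tsum fun n =>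
      (T.measurable_stage π P n (T.measurable_stage_left hb n)).aemeasurable]
    rfl
  have hle : ∀ n, U P ≤ T.discounted c P π + r n := by
    intro n
    refine (T.le_total_horizonStage hc hb hU hUb n hP π).trans ?_
    have h1 : r n = T.total (fun t P a => if t = n then T.stage b t P a else 0) P π := by
      unfold total
      refine lintegral_congr fun ω => ?_
      rw [tsum_ite_eq n fun t => T.stage b t (T.state π P ω t) (T.action π P ω t)]
    rw [h1, discounted_eq_total, ← T.total_add (T.measurable_stage_left hc)]
    refine T.total_le_total hP π fun t P _ a => ?_
    unfold horizonStage
    split_ifs <;> simp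
  have hlim := ENNReal.tendsto_atTop_zero_of_tsum_ne_top (hsum ▸ hfin)
  have hlim' := hlim.const_add (T.discounted c P π)
  rw [add_zero] at hlim'
  exact ge_of_tendsto' hlim' hle

theorem discounted_affine_ne_top {K : ℝ} (hK : 0 ≤ K) {P : ℝ} (hP : 0 < P) {π : TrackingPolicy}
    (h : T.costMetric P π ≠ ∞) : T.discounted (fun P _ => K + K * (T.d * P)) P π ≠ ∞ := by
  rw [T.discounted_add (c₁ := fun _ _ => K) (c₂ := fun P _ => K * (T.d * P))
    (fun _ => measurable_const) (fun _ _ _ => hK)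
    (fun P hP _ => mul_nonneg hK (mul_nonneg T.d_nonneg hP.le)) hP, T.discounted_const hK,
    T.discounted_const_mul hK (fun P _ => T.d * P)]
  refine ENNReal.add_ne_top.2 ⟨ENNReal.ofReal_ne_top,
    ENNReal.mul_ne_top ENNReal.ofReal_ne_top (ne_top_of_le_ne_top h ?_)⟩
  refine T.discounted_mono hP π fun P _ a => ?_
  have := mul_nonneg T.h_nonneg (actionValue_nonneg a)
  unfold cost
  linarith

/-- The stage cost `C(P, a) + l a`, made nonnegative by the addition of `|l|`. -/
noncomputable def shiftedCost (l P : ℝ) (a : Bool) : ℝ := T.cost P a + l * actionValue a + |l|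

theorem shiftedCost_nonneg (l : ℝ) {P : ℝ} (hP : 0 < P) (a : Bool) : 0 ≤ T.shiftedCost l P a := by
  have h1 := T.cost_nonneg hP a
  have h2 := neg_abs_le l
  have h3 := abs_nonneg l
  unfold shiftedCost
  cases a <;> simp [actionValue] <;> linarith

/-- The shift of the stage cost by `|l|` adds the constant `|l| / (1 - β)` to the objective. For
negative `l` the work term is moved to the other side, so that all stage costs stay nonnegative. -/
theorem discounted_shiftedCost_toReal (l : ℝ) {P : ℝ} (hP : 0 < P) {π : TrackingPolicy}
    (h : T.costMetric P π ≠ ∞) :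
    T.discounted (T.shiftedCost l) P π ≠ ∞ ∧ (T.discounted (T.shiftedCost l) P π).toReal =
      (T.costMetric P π).toReal + l * T.workMetric P π + |l| / (1 - T.β) := by
  have hl : 0 ≤ |l| - l := sub_nonneg.2 (le_abs_self l)
  set W := T.discounted (fun _ a => actionValue a) P π
  have hWtop : W ≠ ∞ := T.discounted_work_ne_top P π
  have e1 : T.discounted (fun P a => T.shiftedCost l P a + (|l| - l) * actionValue a) P π =
      T.discounted (T.shiftedCost l) P π + ENNReal.ofReal (|l| - l) * W := by
    rw [T.discounted_add (c₂ := fun _ a => (|l| - l) * actionValue a) (fun a => by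
      unfold shiftedCost cost; fun_prop) (fun P hP a => T.shiftedCost_nonneg l hP a)
      (fun _ _ a => mul_nonneg hl (actionValue_nonneg a)) hP,
      T.discounted_const_mul hl (fun _ a => actionValue a)]
  have e2 : T.discounted (fun P a => T.cost P a + (|l| + |l| * actionValue a)) P π =
      T.costMetric P π + (ENNReal.ofReal (|l| / (1 - T.β)) + ENNReal.ofReal |l| * W) := by
    have hn : ∀ P : ℝ, 0 < P → ∀ a, 0 ≤ |l| * actionValue a := fun _ _ a =>
      mul_nonneg (abs_nonneg l) (actionValue_nonneg a)
    rw [T.discounted_add (c₁ := T.cost) (c₂ := fun _ a => |l| + |l| * actionValue a)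
      T.measurable_cost (fun P hP a => T.cost_nonneg hP a)
      (fun P hP a => add_nonneg (abs_nonneg l) (hn P hP a)) hP,
      T.discounted_add (c₁ := fun _ _ => |l|) (c₂ := fun _ a => |l| * actionValue a)
      (fun _ => measurable_const) (fun _ _ _ => abs_nonneg l) hn hP,
      T.discounted_const (abs_nonneg l),
      T.discounted_const_mul (abs_nonneg l) (fun _ a => actionValue a)]
    rfl
  have e3 : (fun P a => T.shiftedCost l P a + (|l| - l) * actionValue a) =
      fun P a => T.cost P a + (|l| + |l| * actionValue a) := by
    funext P a
    unfold shiftedCost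
    ring
  rw [e3, e2] at e1
  have htop : T.costMetric P π + (ENNReal.ofReal (|l| / (1 - T.β)) + ENNReal.ofReal |l| * W) ≠ ∞ :=
    ENNReal.add_ne_top.2 ⟨h, ENNReal.add_ne_top.2 ⟨ENNReal.ofReal_ne_top,
      ENNReal.mul_ne_top ENNReal.ofReal_ne_top hWtop⟩⟩
  have hJ : T.discounted (T.shiftedCost l) P π ≠ ∞ := by
    rw [e1] at htop
    exact (ENNReal.add_ne_top.1 htop).1
  refine ⟨hJ, ?_⟩
  have e4 := congrArg ENNReal.toReal e1
  have hβ : 0 ≤ |l| / (1 - T.β) := div_nonneg (abs_nonneg l) (by linarith [T.β_lt_one])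
  rw [ENNReal.toReal_add h (ENNReal.add_ne_top.2 ⟨ENNReal.ofReal_ne_top,
      ENNReal.mul_ne_top ENNReal.ofReal_ne_top hWtop⟩), ENNReal.toReal_add ENNReal.ofReal_ne_top
      (ENNReal.mul_ne_top ENNReal.ofReal_ne_top hWtop), ENNReal.toReal_add hJ
      (ENNReal.mul_ne_top ENNReal.ofReal_ne_top hWtop), ENNReal.toReal_mul, ENNReal.toReal_mul,
    ENNReal.toReal_ofReal hl, ENNReal.toReal_ofReal (abs_nonneg l),
    ENNReal.toReal_ofReal hβ] at e4
  change _ = _ + l * W.toReal + _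
  linarith

theorem objective_of_ne_top (l P : ℝ) {π : TrackingPolicy} (h : T.costMetric P π ≠ ∞) :
    T.objective l P π = (((T.costMetric P π).toReal + l * T.workMetric P π : ℝ) : EReal) := by
  unfold objective
  rw [EReal.coe_add, EReal.coe_ennreal_toReal h]

theorem objective_of_eq_top (l P : ℝ) {π : TrackingPolicy} (h : T.costMetric P π = ∞) :
    T.objective l P π = ⊤ := by
  unfold objective
  rw [h]
  exact EReal.top_add_coe _

/-- Verification theorem: a function of at most linear growth in the stage cost `d * P` that lies
below the right-hand side of the Bellman equation for both actions is a lower bound of the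
objective over all policies. -/
theorem le_objective_of_bellman {l : ℝ} {V : ℝ → ℝ} {K : ℝ} (hK : 0 ≤ K)
    (hV : ∀ P, 0 < P → ∀ a, V P ≤ T.cost P a + l * actionValue a + T.β * V (T.φ a P))
    (hVK : ∀ P, 0 < P → V P ≤ K + K * (T.d * P)) {P : ℝ} (hP : 0 < P) (π : TrackingPolicy) :
    (V P : EReal) ≤ T.objective l P π := by
  by_cases h : T.costMetric P π = ∞
  · rw [T.objective_of_eq_top l P h]
    exact le_top
  rw [T.objective_of_ne_top l P h, EReal.coe_le_coe_iff]
  obtain ⟨hJ, hJ'⟩ := T.discounted_shiftedCost_toReal l hP h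
  have hβ : 0 < 1 - T.β := by linarith [T.β_lt_one]
  have hs : 0 ≤ |l| / (1 - T.β) := div_nonneg (abs_nonneg l) hβ.le
  have hs' : |l| / (1 - T.β) = |l| + T.β * (|l| / (1 - T.β)) := by
    field_simp
    ring
  set s := |l| / (1 - T.β)
  have hKs : 0 ≤ K + s := by positivity
  have hle : ENNReal.ofReal (V P + s) ≤ T.discounted (T.shiftedCost l) P π := by
    refine T.le_discounted_of_bellman (b := fun P _ => (K + s) + (K + s) * (T.d * P))
      (U := fun P => ENNReal.ofReal (V P + s)) (fun a => by unfold shiftedCost cost; fun_prop)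
      (fun _ => by fun_prop) (fun P hP a => ?_) (fun P hP _ => ENNReal.ofReal_le_ofReal ?_) hP π
      (T.discounted_affine_ne_top hKs hP h)
    · rw [← ENNReal.ofReal_mul T.β_pos.le]
      refine le_trans (ENNReal.ofReal_le_ofReal ?_) ENNReal.ofReal_add_le
      have := hV P hP a
      unfold shiftedCost
      linarith
    · have h1 := hVK P hP
      have h2 : 0 ≤ s * (T.d * P) := mul_nonneg hs (mul_nonneg T.d_nonneg hP.le)
      linarith
  have := (ENNReal.ofReal_le_iff_le_toReal hJ).1 hle
  linarith

end SmartTarget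

/-! ### Metrics of threshold policies -/

namespace SmartTarget

variable {M : ℕ} (T : SmartTarget M)

/-- Work metric `G(P, z)` of the `z`-threshold policy. -/
noncomputable def thresholdWork (P : ℝ) (z : EReal) : ℝ := T.workMetric P (.threshold z)

/-- Cost metric `F(P, z)` of the `z`-threshold policy, as a real number (`0` when it is infinite). -/
noncomputable def thresholdCost (P : ℝ) (z : EReal) : ℝ := (T.costMetric P (.threshold z)).toReal

theorem thresholdWork_of_lt {P : ℝ} {z : EReal} (h : z < P) :
    T.thresholdWork P z = 1 + T.β * T.thresholdWork (T.φ true P) z := by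
  unfold thresholdWork
  rw [workMetric_threshold, workMetric_startWith]
  simp [h, actionValue]

theorem thresholdWork_of_le {P : ℝ} {z : EReal} (h : P ≤ z) :
    T.thresholdWork P z = T.β * T.thresholdWork (T.φ false P) z := by
  unfold thresholdWork
  rw [workMetric_threshold, workMetric_startWith]
  simp [h.not_gt, actionValue]

theorem thresholdWork_nonneg (P : ℝ) (z : EReal) : 0 ≤ T.thresholdWork P z :=
  T.workMetric_nonneg _ _

theorem thresholdWork_le (P : ℝ) (z : EReal) : T.thresholdWork P z ≤ 1 / (1 - T.β) :=
  T.workMetric_le _ _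

theorem marginalWork_eq (P : ℝ) (z : EReal) :
    T.marginalWork P z =
      1 + T.β * (T.thresholdWork (T.φ true P) z - T.thresholdWork (T.φ false P) z) := by
  unfold marginalWork thresholdWork
  rw [workMetric_startWith, workMetric_startWith]
  simp [actionValue]
  ring

theorem marginalCost_eq {z : EReal} (hz : ∀ P, 0 < P → T.costMetric P (.threshold z) ≠ ∞) {P : ℝ}
    (hP : 0 < P) :
    T.marginalCost P z =
      -T.h + T.β * (T.thresholdCost (T.φ false P) z - T.thresholdCost (T.φ true P) z) := by
  unfold marginalCost thresholdCost
  rw [T.costMetric_startWith_toReal hP _ (hz _ (T.φ_pos _ hP)),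
    T.costMetric_startWith_toReal hP _ (hz _ (T.φ_pos _ hP))]
  simp [cost, actionValue]
  ring

/-- Positive marginal work makes `G(P, ·)` nonincreasing: the policies with thresholds `z₁ ≤ z₂`
differ in the states of `(z₁, z₂]` only, and there each deviation contributes a discounted
marginal work. -/
theorem thresholdWork_antitone (hw : ∀ P : ℝ, 0 < P → ∀ z : EReal, 0 < T.marginalWork P z)
    {P : ℝ} (hP : 0 < P) : Antitone (T.thresholdWork P) := by
  intro z₁ z₂ hz
  have hβ0 := T.β_pos
  have hβ : 0 < 1 - T.β := by linarith [T.β_lt_one]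
  have key : ∀ n : ℕ, ∀ P, 0 < P →
      -(T.β ^ n * (1 / (1 - T.β))) ≤ T.thresholdWork P z₁ - T.thresholdWork P z₂ := by
    intro n
    induction n with
    | zero =>
      intro P _
      have h1 := T.thresholdWork_nonneg P z₁
      have h2 := T.thresholdWork_le P z₂
      simp only [pow_zero, one_mul]
      linarith
    | succ n ih =>
      intro P hP
      have h1 := mul_le_mul_of_nonneg_left (ih _ (T.φ_pos true hP)) hβ0.le
      have h0 := mul_le_mul_of_nonneg_left (ih _ (T.φ_pos false hP)) hβ0.le
      have e : T.β * -(T.β ^ n * (1 / (1 - T.β))) = -(T.β ^ (n + 1) * (1 / (1 - T.β))) := by ring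
      rw [e] at h1 h0
      rcases lt_or_ge z₂ (P : EReal) with h | h
      · rw [T.thresholdWork_of_lt h, T.thresholdWork_of_lt (hz.trans_lt h)]
        linarith
      rcases lt_or_ge z₁ (P : EReal) with h' | h'
      · rw [T.thresholdWork_of_lt h', T.thresholdWork_of_le h]
        have h2 := hw P hP z₂
        rw [marginalWork_eq] at h2
        linarith
      · rw [T.thresholdWork_of_le h, T.thresholdWork_of_le h']
        linarith
  have hlim : Filter.Tendsto (fun n : ℕ => -(T.β ^ n * (1 / (1 - T.β)))) Filter.atTop
      (nhds (-(0 * (1 / (1 - T.β))))) :=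
    ((tendsto_pow_atTop_nhds_zero_of_lt_one hβ0.le T.β_lt_one).mul_const _).neg
  have := le_of_tendsto' hlim fun n => key n P hP
  linarith

theorem thresholdCost_of_le {P : ℝ} (hP : 0 < P) {z : EReal} (h : P ≤ z)
    (hf : T.costMetric (T.φ false P) (.threshold z) ≠ ∞) :
    T.thresholdCost P z = T.cost P false + T.β * T.thresholdCost (T.φ false P) z := by
  unfold thresholdCost
  rw [costMetric_threshold, ← T.costMetric_startWith_toReal hP _ hf]
  simp [h.not_gt]

/-- The seed `1` leads to the passive action even where the active one has probability `1`; it has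
probability zero. -/
theorem ae_seed_lt_one : ∀ᵐ ω ∂seedLaw, ∀ t, ω t < 1 := by
  refine ae_all_iff.2 fun t => ?_
  have h1 : ∀ᵐ s : unitInterval, s ≠ 1 := by simp [ae_iff]
  have h2 := (measurePreserving_eval_infinitePi (fun _ : ℕ => (volume : Measure unitInterval))
    t).quasiMeasurePreserving.ae h1
  filter_upwards [h2] with ω hω
  exact lt_of_le_of_ne unitInterval.le_one' hω

/-- The cost metric of the policy that always tracks. -/
theorem costMetric_threshold_zero {P : ℝ} (hP : 0 < P) :
    T.costMetric P (.threshold 0) =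
      ∑' t : ℕ, ENNReal.ofReal (T.β ^ t * T.cost ((T.φ true)^[t] P) true) := by
  have h : ∀ᵐ ω ∂seedLaw, (∑' t : ℕ, ENNReal.ofReal (T.β ^ t *
      T.cost (T.state (.threshold 0) P ω t) (T.action (.threshold 0) P ω t))) =
      ∑' t : ℕ, ENNReal.ofReal (T.β ^ t * T.cost ((T.φ true)^[t] P) true) := by
    filter_upwards [ae_seed_lt_one] with ω hω
    have hact : ∀ t, T.action (.threshold 0) P ω t = true := by
      intro t
      have hp : (0 : EReal) < (T.state (.threshold 0) P ω t : EReal) :=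
        EReal.coe_pos.2 (T.state_pos (.threshold 0) hP ω t)
      have h1 : (TrackingPolicy.threshold 0).prob t (T.state (.threshold 0) P ω t) = 1 := if_pos hp
      unfold action TrackingPolicy.act
      rw [h1]
      exact decide_eq_true (hω t)
    have hst : ∀ t, T.state (.threshold 0) P ω t = (T.φ true)^[t] P := by
      intro t
      induction t with
      | zero => rfl
      | succ t ih =>
        rw [Function.iterate_succ_apply', ← ih, ← hact t]
        rfl
    simp only [hact, hst]
  unfold costMetric discounted
  rw [lintegral_congr_ae h, lintegral_const, measure_univ, mul_one]

/-- The cost metric of the policy that never tracks. -/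
theorem costMetric_threshold_top (P : ℝ) :
    T.costMetric P (.threshold ⊤) =
      ∑' t : ℕ, ENNReal.ofReal (T.β ^ t * T.cost ((T.φ false)^[t] P) false) := by
  have hact : ∀ ω t, T.action (.threshold ⊤) P ω t = false := by
    intro ω t
    simp [action, TrackingPolicy.act, TrackingPolicy.threshold]
  have hst : ∀ ω t, T.state (.threshold ⊤) P ω t = (T.φ false)^[t] P := by
    intro ω t
    induction t with
    | zero => rfl
    | succ t ih =>
      rw [Function.iterate_succ_apply', ← ih, ← hact ω t]
      rfl
  unfold costMetric discounted
  simp only [hact, hst]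
  rw [lintegral_const, measure_univ, mul_one]

/-- Below the threshold the state follows the untracked orbit. -/
theorem sum_le_costMetric_threshold {z : ℝ} (n : ℕ) {P : ℝ}
    (h : ∀ t < n, (T.φ false)^[t] P ≤ z) :
    ∑ t ∈ Finset.range n, ENNReal.ofReal (T.β ^ t * T.cost ((T.φ false)^[t] P) false) ≤
      T.costMetric P (.threshold z) := by
  induction n generalizing P with
  | zero => simp
  | succ n ih =>
    have h0 : ¬((z : EReal) < (P : EReal)) := by
      simpa using h 0 n.succ_pos
    rw [costMetric_threshold, costMetric_startWith, decide_eq_false h0, Finset.sum_range_succ',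
      add_comm]
    refine add_le_add (by simp) ?_
    refine le_trans (le_of_eq ?_) (mul_le_mul_right (ih (P := T.φ false P) fun t ht => by
      simpa using h (t + 1) (by omega)) (ENNReal.ofReal T.β))
    rw [Finset.mul_sum]
    refine Finset.sum_congr rfl fun t _ => ?_
    rw [← ENNReal.ofReal_mul T.β_pos.le, Function.iterate_succ_apply]
    ring_nf

theorem updVar_eq (m : Fin M) {P : ℝ} (hP : 0 < P) :
    T.updVar m P = T.R * T.predVar m P / (T.H * T.predVar m P * T.H + T.R) := by
  have h1 := T.predVar_pos m hP
  have h2 := T.R_pos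
  have h3 : 0 < T.H * T.predVar m P * T.H + T.R := by nlinarith [mul_self_nonneg T.H]
  unfold updVar gain
  field_simp
  ring

theorem predVar_mul_le (m : Fin M) {k P Q : ℝ} (hk : 1 ≤ k) (h : P ≤ k * Q) :
    T.predVar m P ≤ k * T.predVar m Q := by
  have h1 := T.noiseVar_pos m
  have h2 := mul_self_nonneg (T.trans m)
  unfold predVar
  nlinarith [mul_le_mul_of_nonneg_left h h2]

theorem updVar_mul_le (m : Fin M) {k P Q : ℝ} (hk : 1 ≤ k) (hP : 0 < P) (hQ : 0 < Q)
    (h : P ≤ k * Q) : T.updVar m P ≤ k * T.updVar m Q := by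
  have hp := T.predVar_pos m hP
  have hq := T.predVar_pos m hQ
  have hR := T.R_pos
  have hpq := T.predVar_mul_le m hk h
  rw [T.updVar_eq m hP, T.updVar_eq m hQ]
  set p := T.predVar m P
  set q := T.predVar m Q
  have hH := mul_self_nonneg T.H
  have hp' : 0 < T.H * p * T.H + T.R := by nlinarith
  have hq' : 0 < T.H * q * T.H + T.R := by nlinarith
  rw [← mul_div_assoc, div_le_div_iff₀ hp' hq']
  have h1 : 0 ≤ (T.R * (k * q - p)) * T.R :=
    mul_nonneg (mul_nonneg hR.le (by linarith)) hR.le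
  have h2 : 0 ≤ (k - 1) * (T.R * p * q * (T.H * T.H)) :=
    mul_nonneg (by linarith) (by positivity)
  nlinarith

theorem φ_true_mul_le {k P Q : ℝ} (hk : 1 ≤ k) (hP : 0 < P) (hQ : 0 < Q) (h : P ≤ k * Q) :
    T.φ true P ≤ k * T.φ true Q := by
  unfold φ
  simp only
  rw [Finset.mul_sum]
  refine Finset.sum_le_sum fun m _ => ?_
  have := mul_le_mul_of_nonneg_left (T.updVar_mul_le m hk hP hQ h) (T.u_nonneg true m)
  linarith

theorem iterate_φ_pos (a : Bool) {P : ℝ} (hP : 0 < P) (t : ℕ) : 0 < (T.φ a)^[t] P := by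
  induction t with
  | zero => exact hP
  | succ t ih =>
    rw [Function.iterate_succ_apply']
    exact T.φ_pos a ih

/-- `φ¹` is nondecreasing and `φ¹(k P) ≤ k φ¹(P)` for `k ≥ 1`, which makes `F(P, 0)` grow at most
linearly in `P`. -/
theorem costMetric_threshold_zero_le {k P : ℝ} (hk : 1 ≤ k) (hP : 0 < P) (h : P ≤ k) :
    T.costMetric P (.threshold 0) ≤ ENNReal.ofReal k * T.costMetric 1 (.threshold 0) := by
  have hit : ∀ t, (T.φ true)^[t] P ≤ k * (T.φ true)^[t] 1 := by
    intro t
    induction t with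
    | zero => simpa using h
    | succ t ih =>
      rw [Function.iterate_succ_apply', Function.iterate_succ_apply']
      exact T.φ_true_mul_le hk (T.iterate_φ_pos true hP t) (T.iterate_φ_pos true one_pos t) ih
  rw [T.costMetric_threshold_zero hP, T.costMetric_threshold_zero one_pos, ← ENNReal.tsum_mul_left]
  refine ENNReal.tsum_le_tsum fun t => ?_
  rw [← ENNReal.ofReal_mul (by linarith)]
  refine ENNReal.ofReal_le_ofReal ?_
  have h1 := mul_le_mul_of_nonneg_left (hit t) T.d_nonneg
  have h2 := mul_le_mul_of_nonneg_right hk T.h_nonneg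
  have h3 : T.cost ((T.φ true)^[t] P) true ≤ k * T.cost ((T.φ true)^[t] 1) true := by
    simp [cost, actionValue]
    linarith
  have := mul_le_mul_of_nonneg_left h3 (pow_nonneg T.β_pos.le t)
  linarith

/-- `F(P, 0)` is at most affine in `d * P`. -/
theorem exists_thresholdCost_zero_le (hfin : ∀ P, 0 < P → T.costMetric P (.threshold 0) ≠ ∞) :
    ∃ K, 0 ≤ K ∧ ∀ P, 0 < P → T.thresholdCost P 0 ≤ K + K * (T.d * P) := by
  have hβ : 0 < 1 - T.β := by linarith [T.β_lt_one]
  rcases T.d_nonneg.eq_or_lt with hd | hd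
  · refine ⟨T.h / (1 - T.β), div_nonneg T.h_nonneg hβ.le, fun P hP => ?_⟩
    rw [← hd]
    simp only [zero_mul, mul_zero, add_zero]
    refine ENNReal.toReal_le_of_le_ofReal (div_nonneg T.h_nonneg hβ.le) ?_
    rw [← T.discounted_const T.h_nonneg P (.threshold 0)]
    refine T.discounted_mono hP _ fun P _ a => ?_
    have := mul_le_mul_of_nonneg_left (actionValue_le_one a) T.h_nonneg
    unfold cost
    rw [← hd]
    linarith
  · set S := T.thresholdCost 1 0
    have hS : 0 ≤ S := ENNReal.toReal_nonneg
    refine ⟨S + S / T.d, by positivity, fun P hP => ?_⟩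
    have h1 := T.costMetric_threshold_zero_le (k := 1 + P) (by linarith) hP (by linarith)
    have h2 := ENNReal.toReal_mono (ENNReal.mul_ne_top ENNReal.ofReal_ne_top (hfin 1 one_pos)) h1
    rw [ENNReal.toReal_mul, ENNReal.toReal_ofReal (by linarith)] at h2
    change T.thresholdCost P 0 ≤ (1 + P) * S at h2
    have h3 : S / T.d * (T.d * P) = S * P := by field_simp
    have h4 : 0 ≤ S / T.d := by positivity
    have h5 : 0 ≤ S * (T.d * P) := by positivity
    nlinarith

end SmartTarget

/-! ### Lebesgue–Stieltjes integrals against monotone functions -/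

/-- For nonincreasing `A`, the integral of `φ` against `-dA` over `(z₁, z₂]` lies between the bounds
of `φ` on this interval times the decrease of `A`. -/
theorem HasLebesgueStieltjesIntegral.bounds {A φ : ℝ → ℝ} {I : ℝ → ℝ → ℝ}
    (h : HasLebesgueStieltjesIntegral A φ I) (hA : Antitone A) {z₁ z₂ : ℝ} (hz : z₁ < z₂) :
    (∀ m, (∀ z ∈ Ioc z₁ z₂, m ≤ φ z) → m * (A z₁ - A z₂) ≤ -I z₁ z₂) ∧
      ∀ m, (∀ z ∈ Ioc z₁ z₂, φ z ≤ m) → -I z₁ z₂ ≤ m * (A z₁ - A z₂) := by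
  obtain ⟨γ₁, γ₂, hγ, hI⟩ := h
  obtain ⟨hi₁, hi₂, e⟩ := hI z₁ z₂ hz
  let γ : StieltjesFunction ℝ :=
    { toFun := fun z => γ₂ z - γ₁ z
      mono' := fun a b hab => by
        have := hA hab
        rw [hγ, hγ] at this
        simp only
        linarith
      right_continuous' := fun x => (γ₂.right_continuous x).sub (γ₁.right_continuous x) }
  have hsum : γ₂ = γ₁ + γ := by
    ext z
    simp [γ]
  have hm : γ₂.measure = γ₁.measure + γ.measure := by rw [hsum, StieltjesFunction.measure_add]
  have hγA : γ z₂ - γ z₁ = A z₁ - A z₂ := by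
    rw [hγ, hγ]
    simp only [γ]
    ring
  rw [hm] at hi₂ e
  have hi : IntegrableOn φ (Ioc z₁ z₂) γ.measure := hi₂.mono_measure (Measure.le_add_left le_rfl)
  rw [Measure.restrict_add, integral_add_measure hi₁ hi] at e
  have e' : -I z₁ z₂ = ∫ z in Ioc z₁ z₂, φ z ∂γ.measure := by linarith
  have hc : ∀ m : ℝ, ∫ _ in Ioc z₁ z₂, m ∂γ.measure = m * (A z₁ - A z₂) := by
    intro m
    rw [setIntegral_const, Measure.real, StieltjesFunction.measure_Ioc, hγA,
      ENNReal.toReal_ofReal (by linarith [hA hz.le]), smul_eq_mul, mul_comm]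
  have hic : ∀ m : ℝ, IntegrableOn (fun _ => m) (Ioc z₁ z₂) γ.measure := fun m => by
    refine integrableOn_const ?_
    rw [StieltjesFunction.measure_Ioc]
    exact ENNReal.ofReal_ne_top
  refine ⟨fun m hm => ?_, fun m hm => ?_⟩
  · rw [e', ← hc m]
    exact setIntegral_mono_on (hic m) hi measurableSet_Ioc hm
  · rw [e', ← hc m]
    exact setIntegral_mono_on hi (hic m) measurableSet_Ioc hm

theorem HasLebesgueStieltjesIntegral.continuousWithinAt {A φ : ℝ → ℝ} {I : ℝ → ℝ → ℝ}
    (h : HasLebesgueStieltjesIntegral A φ I) (z : ℝ) : ContinuousWithinAt A (Ici z) z := by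
  obtain ⟨γ₁, γ₂, hγ, -⟩ := h
  have : A = fun z => γ₁ z - γ₂ z := funext hγ
  rw [this]
  exact (γ₁.right_continuous z).sub (γ₂.right_continuous z)

/-! ### Monotonicity of the gap between marginal cost and priced marginal work -/

section Gap

variable {m a₀ a₁ b₀ b₁ f g : ℝ → ℝ} {c c' : ℝ}

/-- With `f = c + b₀ - b₁`, `g = c' + a₁ - a₀` and `db_i = -m da_i` in the sense of the bounds `hb₀`,
`hb₁`, the increments of `f - m g` are comparable to those of `m`. -/
theorem gap_sub_bounds
    (hb₀ : ∀ x y, 0 ≤ x → x < y →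
      m x * (a₀ x - a₀ y) ≤ b₀ y - b₀ x ∧ b₀ y - b₀ x ≤ m y * (a₀ x - a₀ y))
    (hb₁ : ∀ x y, 0 ≤ x → x < y →
      m x * (a₁ x - a₁ y) ≤ b₁ y - b₁ x ∧ b₁ y - b₁ x ≤ m y * (a₁ x - a₁ y))
    (hf : ∀ z, f z = c + b₀ z - b₁ z) (hg : ∀ z, g z = c' + a₁ z - a₀ z)
    {x y : ℝ} (hx : 0 ≤ x) (hxy : x < y) :
    (m y - m x) * (g x - (a₁ x - a₁ y)) ≤ (f x - m x * g x) - (f y - m y * g y) ∧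
      (f x - m x * g x) - (f y - m y * g y) ≤ (m y - m x) * (g x + (a₀ x - a₀ y)) := by
  obtain ⟨h1, h2⟩ := hb₀ x y hx hxy
  obtain ⟨h3, h4⟩ := hb₁ x y hx hxy
  rw [hf, hf, hg, hg]
  constructor <;> nlinarith

/-- The gap `f - m g` is nonincreasing, and decreases strictly wherever `m` increases. This is
integration by parts, `d(f - m g) = -g dm`, with `g > 0`; it is proved by continuous induction. -/
theorem gap_antitone (hm : MonotoneOn m (Ici 0)) (hmc : ContinuousOn m (Ici 0))
    (ha₀ : Antitone a₀) (ha₁ : Antitone a₁) (hc₁ : ∀ z, ContinuousWithinAt a₁ (Ici z) z)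
    (hb₀ : ∀ x y, 0 ≤ x → x < y →
      m x * (a₀ x - a₀ y) ≤ b₀ y - b₀ x ∧ b₀ y - b₀ x ≤ m y * (a₀ x - a₀ y))
    (hb₁ : ∀ x y, 0 ≤ x → x < y →
      m x * (a₁ x - a₁ y) ≤ b₁ y - b₁ x ∧ b₁ y - b₁ x ≤ m y * (a₁ x - a₁ y))
    (hf : ∀ z, f z = c + b₀ z - b₁ z) (hg : ∀ z, g z = c' + a₁ z - a₀ z)
    (hgpos : ∀ z, 0 ≤ z → 0 < g z) {a b : ℝ} (ha : 0 ≤ a) (hab : a ≤ b) :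
    f b - m b * g b ≤ f a - m a * g a ∧ (m a < m b → f b - m b * g b < f a - m a * g a) ∧
      (m a = m b → f a - m a * g a = f b - m b * g b) := by
  set Φ : ℝ → ℝ := fun z => f z - m z * g z
  have hbd : ∀ x y, 0 ≤ x → x < y → (m y - m x) * (g x - (a₁ x - a₁ y)) ≤ Φ x - Φ y ∧
      Φ x - Φ y ≤ (m y - m x) * (g x + (a₀ x - a₀ y)) :=
    fun x y hx hxy => gap_sub_bounds hb₀ hb₁ hf hg hx hxy
  -- To the right of each point `m y - m x` has a positive factor, by right-continuity of `a₁`.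
  have hloc : ∀ x, 0 ≤ x → ∀ᶠ y in nhdsWithin x (Ioi x), Φ y ≤ Φ x ∧ (Φ y = Φ x → m y = m x) := by
    intro x hx
    have h1 : Filter.Tendsto a₁ (nhdsWithin x (Ioi x)) (nhds (a₁ x)) :=
      (hc₁ x).mono Ioi_subset_Ici_self
    have h2 : ∀ᶠ y in nhdsWithin x (Ioi x), a₁ x - g x < a₁ y :=
      h1.eventually (lt_mem_nhds (by linarith [hgpos x hx]))
    filter_upwards [h2, self_mem_nhdsWithin] with y hy hxy
    have h3 := (hbd x y hx hxy).1
    have h4 : m x ≤ m y := hm hx (hx.trans (le_of_lt hxy)) (le_of_lt hxy)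
    have h5 : 0 < g x - (a₁ x - a₁ y) := by linarith
    refine ⟨by nlinarith, fun h => ?_⟩
    rw [h, sub_self] at h3
    nlinarith
  have hsub : Icc a b ⊆ Ici 0 := fun x hx => ha.trans hx.1
  have hΦc : ContinuousOn Φ (Icc a b) := by
    obtain ⟨C, hC⟩ : ∃ C, ∀ x ∈ Icc a b, ∀ y ∈ Icc a b, x < y → |Φ x - Φ y| ≤ C * |m x - m y| := by
      refine ⟨(c' + a₁ a - a₀ b) + (a₀ a - a₀ b) + (a₁ a - a₁ b), fun x hx y hy hxy => ?_⟩
      obtain ⟨h1, h2⟩ := hbd x y (hsub hx) hxy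
      have h3 : 0 ≤ m y - m x := sub_nonneg.2 (hm (hsub hx) (hsub hy) hxy.le)
      have h4 := hgpos x (hsub hx)
      have h5 := hg x
      have p1 := ha₀ hx.1
      have p2 := ha₀ hxy.le
      have p3 := ha₀ hy.2
      have q1 := ha₁ hx.1
      have q2 := ha₁ hxy.le
      have q3 := ha₁ hy.2
      rw [abs_sub_comm (m x), abs_of_nonneg h3, abs_le]
      constructor <;> nlinarith
    have hC' : ∀ x ∈ Icc a b, ∀ y ∈ Icc a b, |Φ x - Φ y| ≤ C * |m x - m y| := by
      intro x hx y hy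
      rcases lt_trichotomy x y with h | h | h
      · exact hC x hx y hy h
      · simp [h]
      · rw [abs_sub_comm, abs_sub_comm (m x)]
        exact hC y hy x hx h
    intro x hx
    have h1 : Filter.Tendsto m (nhdsWithin x (Icc a b)) (nhds (m x)) :=
      (hmc x (hsub hx)).mono hsub
    have h2 : Filter.Tendsto (fun y => C * |m y - m x|) (nhdsWithin x (Icc a b)) (nhds 0) := by
      have := ((h1.sub_const (m x)).abs).const_mul C
      simpa using this
    refine tendsto_iff_dist_tendsto_zero.2 (squeeze_zero' (Filter.Eventually.of_forall fun _ =>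
      dist_nonneg) ?_ h2)
    filter_upwards [self_mem_nhdsWithin] with y hy
    exact hC' y hy x hx
  have hanti : ∀ x, a ≤ x → x ≤ b → Φ x ≤ Φ a := by
    have hcl : IsClosed ({x | Φ x ≤ Φ a} ∩ Icc a b) := by
      rw [inter_comm]
      exact hΦc.preimage_isClosed_of_isClosed isClosed_Icc isClosed_Iic
    have := hcl.Icc_subset_of_forall_mem_nhdsWithin (le_refl (Φ a)) (fun x hx => by
      filter_upwards [hloc x (ha.trans hx.2.1)] with y hy
      exact hy.1.trans hx.1)
    exact fun x h1 h2 => this ⟨h1, h2⟩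
  have hanti' : ∀ x, a ≤ x → x ≤ b → Φ b ≤ Φ x := by
    intro x hax hxb
    have hcl : IsClosed ({y | Φ y ≤ Φ x} ∩ Icc x b) := by
      rw [inter_comm]
      exact (hΦc.mono (Icc_subset_Icc_left hax)).preimage_isClosed_of_isClosed isClosed_Icc
        isClosed_Iic
    exact hcl.Icc_subset_of_forall_mem_nhdsWithin (le_refl (Φ x)) (fun y hy => by
      filter_upwards [hloc y (ha.trans (hax.trans hy.2.1))] with y' hy'
      exact hy'.1.trans hy.1) ⟨hxb, le_rfl⟩
  have hle := hanti b hab le_rfl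
  refine ⟨hle, fun hlt => lt_of_le_of_ne hle fun heq => ?_, fun heq => ?_⟩
  · -- If the gap does not decrease, it is constant on `[a, b]`, and so is then `m`.
    have hconst : ∀ x, a ≤ x → x ≤ b → Φ x = Φ a := fun x h1 h2 =>
      le_antisymm (hanti x h1 h2) ((show Φ a = Φ b from heq.symm).le.trans (hanti' x h1 h2))
    have hcl : IsClosed ({x | m x = m a} ∩ Icc a b) := by
      rw [inter_comm]
      exact (hmc.mono hsub).preimage_isClosed_of_isClosed isClosed_Icc isClosed_singleton
    have h1 : b ∈ {x | m x = m a} :=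
      hcl.Icc_subset_of_forall_mem_nhdsWithin (rfl : m a = m a) (fun x hx => by
        filter_upwards [hloc x (ha.trans hx.2.1), Ioc_mem_nhdsGT hx.2.2] with y hy hxy
        have h2 := hy.2 (by
          rw [hconst x hx.2.1 hx.2.2.le, hconst y (hx.2.1.trans hxy.1.le) hxy.2])
        exact h2.trans hx.1) ⟨hab, le_rfl⟩
    exact hlt.ne' h1
  · rcases hab.eq_or_lt with h | h
    · rw [h]
    · obtain ⟨h1, h2⟩ := hbd a b ha h
      rw [heq, sub_self, zero_mul] at h1 h2
      change Φ a = Φ b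
      linarith

end Gap

namespace SmartTarget

variable {M : ℕ} (T : SmartTarget M)

open Classical in
/-- The marginal productivity index, extended to `[0, ∞)` by its infimum at `0`. -/
noncomputable def mpExt (z : ℝ) : ℝ := if 0 < z then T.mpIndex z else sInf (T.mpIndex '' Ioi 0)

/-- The gap `f(P, z) - mp*(z) g(P, z)` between the marginal cost and the marginal work priced at
the index of the threshold. -/
noncomputable def gap (P z : ℝ) : ℝ := T.marginalCost P z - T.mpExt z * T.marginalWork P z

variable {T}

theorem mpExt_of_pos {z : ℝ} (hz : 0 < z) : T.mpExt z = T.mpIndex z := if_pos hz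

theorem mpExt_zero : T.mpExt 0 = sInf (T.mpIndex '' Ioi 0) := if_neg (lt_irrefl 0)

namespace PCLIndexable

variable (hT : T.PCLIndexable)

include hT

theorem mpExt_monotoneOn : MonotoneOn T.mpExt (Ici 0) := by
  intro x hx y hy hxy
  rcases (show 0 ≤ x from hx).eq_or_lt with h | h
  · rcases (show 0 ≤ y from hy).eq_or_lt with h' | h'
    · rw [← h, ← h']
    · rw [← h, mpExt_zero, mpExt_of_pos h']
      exact csInf_le hT.mp_bddBelow ⟨y, h', rfl⟩
  · rw [mpExt_of_pos h, mpExt_of_pos (h.trans_le hxy)]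
    exact hT.mp_mono h (h.trans_le hxy) hxy

theorem mpExt_continuousOn : ContinuousOn T.mpExt (Ici 0) := by
  have heq : EqOn T.mpIndex T.mpExt (Ioi 0) := fun z hz => (mpExt_of_pos hz).symm
  intro x hx
  rcases (show 0 ≤ x from hx).eq_or_lt with h | h
  · subst h
    have h1 : Filter.Tendsto T.mpExt (nhdsWithin 0 (Ioi 0)) (nhds (T.mpExt 0)) := by
      rw [mpExt_zero]
      exact (hT.mp_mono.tendsto_nhdsGT hT.mp_bddBelow).congr'
        (eventually_nhdsWithin_of_forall heq)
    exact continuousWithinAt_Ioi_iff_Ici.1 h1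
  · have h1 := (hT.mp_cont x h).continuousAt (Ioi_mem_nhds h)
    exact (h1.congr (Filter.eventuallyEq_of_mem (Ioi_mem_nhds h) heq)).continuousWithinAt

theorem thresholdWork_antitone_coe {P : ℝ} (hP : 0 < P) :
    Antitone fun z : ℝ => T.thresholdWork P z := fun _ _ h =>
  T.thresholdWork_antitone hT.work_pos hP (EReal.coe_le_coe_iff.2 h)

theorem thresholdCost_sub_bounds {P : ℝ} (hP : 0 < P) {x y : ℝ} (hx : 0 ≤ x) (hxy : x < y) :
    T.mpExt x * (T.thresholdWork P x - T.thresholdWork P y) ≤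
        T.thresholdCost P y - T.thresholdCost P x ∧
      T.thresholdCost P y - T.thresholdCost P x ≤
        T.mpExt y * (T.thresholdWork P x - T.thresholdWork P y) := by
  obtain ⟨h1, h2⟩ := (hT.cost_eq_integral P hP).bounds (hT.thresholdWork_antitone_coe hP) hxy
  rw [neg_sub] at h1 h2
  refine ⟨h1 _ fun z hz => ?_, h2 _ fun z hz => ?_⟩
  · rw [← mpExt_of_pos (hx.trans_lt hz.1)]
    exact hT.mpExt_monotoneOn hx (hx.trans hz.1.le) hz.1.le
  · rw [← mpExt_of_pos (hx.trans_lt hz.1)]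
    exact hT.mpExt_monotoneOn (hx.trans hz.1.le) (hx.trans hxy.le) hz.2

theorem costMetric_ne_top {P : ℝ} (hP : 0 < P) (z : ℝ) : T.costMetric P (.threshold z) ≠ ∞ :=
  (hT.cost_finite P hP z).ne

theorem gap_antitone {P : ℝ} (hP : 0 < P) {a b : ℝ} (ha : 0 ≤ a) (hab : a ≤ b) :
    T.gap P b ≤ T.gap P a ∧ (T.mpExt a < T.mpExt b → T.gap P b < T.gap P a) ∧
      (T.mpExt a = T.mpExt b → T.gap P a = T.gap P b) := by
  have hβ := T.β_pos.le
  have hW : ∀ i, Antitone fun z : ℝ => T.β * T.thresholdWork (T.φ i P) z := fun i =>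
    (hT.thresholdWork_antitone_coe (T.φ_pos i hP)).const_mul hβ
  have hB : ∀ i x y, 0 ≤ x → x < y →
      T.mpExt x * (T.β * T.thresholdWork (T.φ i P) x - T.β * T.thresholdWork (T.φ i P) y) ≤
          T.β * T.thresholdCost (T.φ i P) y - T.β * T.thresholdCost (T.φ i P) x ∧
        T.β * T.thresholdCost (T.φ i P) y - T.β * T.thresholdCost (T.φ i P) x ≤
          T.mpExt y *
            (T.β * T.thresholdWork (T.φ i P) x - T.β * T.thresholdWork (T.φ i P) y) := by
    intro i x y hx hxy
    obtain ⟨h1, h2⟩ := hT.thresholdCost_sub_bounds (T.φ_pos i hP) hx hxy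
    have h1' := mul_le_mul_of_nonneg_left h1 hβ
    have h2' := mul_le_mul_of_nonneg_left h2 hβ
    constructor <;> linarith
  refine _root_.gap_antitone (m := T.mpExt)
    (a₀ := fun z => T.β * T.thresholdWork (T.φ false P) z)
    (a₁ := fun z => T.β * T.thresholdWork (T.φ true P) z)
    (b₀ := fun z => T.β * T.thresholdCost (T.φ false P) z)
    (b₁ := fun z => T.β * T.thresholdCost (T.φ true P) z)
    (f := fun z => T.marginalCost P z) (g := fun z => T.marginalWork P z) (c := -T.h) (c' := 1)
    hT.mpExt_monotoneOn hT.mpExt_continuousOn (hW false) (hW true)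
    (fun z => ((hT.cost_eq_integral _ (T.φ_pos true hP)).continuousWithinAt z).const_mul T.β)
    (hB false) (hB true) (fun z => ?_) (fun z => ?_) (fun z _ => hT.work_pos P hP z) ha hab
  · rw [T.marginalCost_eq (fun P hP => hT.costMetric_ne_top hP z) hP]
    ring
  · rw [T.marginalWork_eq]
    ring

theorem gap_self {P : ℝ} (hP : 0 < P) : T.gap P P = 0 := by
  have := (hT.work_pos P hP P).ne'
  unfold gap
  rw [mpExt_of_pos hP, mpIndex]
  field_simp
  ring

theorem gap_pos {P z : ℝ} (hP : 0 < P) (hz : 0 ≤ z) (h : T.mpExt z < T.mpIndex P) :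
    0 < T.gap P z := by
  rw [← mpExt_of_pos hP] at h
  have hzP : z ≤ P := by
    by_contra! hlt
    exact h.not_ge (hT.mpExt_monotoneOn hP.le hz hlt.le)
  rw [← hT.gap_self hP]
  exact (hT.gap_antitone hP hz hzP).2.1 h

theorem gap_neg {P z : ℝ} (hP : 0 < P) (hz : 0 ≤ z) (h : T.mpIndex P < T.mpExt z) :
    T.gap P z < 0 := by
  rw [← mpExt_of_pos hP] at h
  have hzP : P ≤ z := by
    by_contra! hlt
    exact h.not_ge (hT.mpExt_monotoneOn hz hP.le hlt.le)
  rw [← hT.gap_self hP]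
  exact (hT.gap_antitone hP hP.le hzP).2.1 h

theorem gap_eq_zero {P z : ℝ} (hP : 0 < P) (hz : 0 ≤ z) (h : T.mpExt z = T.mpIndex P) :
    T.gap P z = 0 := by
  rw [← mpExt_of_pos hP] at h
  rw [← hT.gap_self hP]
  rcases le_total z P with hzP | hzP
  · exact (hT.gap_antitone hP hz hzP).2.2 h
  · exact ((hT.gap_antitone hP hP.le hzP).2.2 h.symm).symm

end PCLIndexable

end SmartTarget

/-! ### Never tracking as a limit of threshold policies -/

namespace SmartTarget

variable {M : ℕ} {T : SmartTarget M}

/-- A quantity that is discounted along the untracked orbit as long as the orbit stays below the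
threshold, and whose bound is outweighed by the discounting, vanishes as the threshold grows. -/
theorem tendsto_zero_of_discounted {E : ℝ → ℝ → ℝ} {b : ℝ → ℝ}
    (hE : ∀ P, 0 < P → ∀ z, P ≤ z → E P z = T.β * E (T.φ false P) z)
    (hb : ∀ P, 0 < P → ∀ z, 0 ≤ z → |E P z| ≤ b P) {P : ℝ} (hP : 0 < P)
    (hlim : Filter.Tendsto (fun n : ℕ => T.β ^ n * b ((T.φ false)^[n] P)) Filter.atTop (nhds 0)) :
    Filter.Tendsto (E P) Filter.atTop (nhds 0) := by
  have key : ∀ n : ℕ, ∀ P, 0 < P →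
      ∀ᶠ z in Filter.atTop, |E P z| ≤ T.β ^ n * b ((T.φ false)^[n] P) := by
    intro n
    induction n with
    | zero =>
      intro P hP
      filter_upwards [Filter.eventually_ge_atTop 0] with z hz
      simpa using hb P hP z hz
    | succ n ih =>
      intro P hP
      filter_upwards [ih _ (T.φ_pos false hP), Filter.eventually_ge_atTop P] with z hz hPz
      rw [hE P hP z hPz, abs_mul, abs_of_pos T.β_pos, Function.iterate_succ_apply, pow_succ']
      rw [mul_assoc]
      exact mul_le_mul_of_nonneg_left hz T.β_pos.le
  rw [Metric.tendsto_nhds]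
  intro ε hε
  obtain ⟨n, hn⟩ := (hlim.eventually (gt_mem_nhds hε)).exists
  filter_upwards [key n P hP] with z hz
  rw [Real.dist_eq, sub_zero]
  exact hz.trans_lt hn

theorem tendsto_untracked_discounted {P : ℝ} (hP : 0 < P) (h : T.costMetric P (.threshold ⊤) ≠ ∞) :
    Filter.Tendsto (fun n : ℕ => T.β ^ n * (T.d * (T.φ false)^[n] P)) Filter.atTop (nhds 0) := by
  rw [T.costMetric_threshold_top] at h
  have h1 := (ENNReal.tendsto_toReal ENNReal.zero_ne_top).comp
    (ENNReal.tendsto_atTop_zero_of_tsum_ne_top h)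
  rw [ENNReal.toReal_zero] at h1
  refine h1.congr fun n => ?_
  have h2 := mul_nonneg (pow_nonneg T.β_pos.le n) (T.cost_nonneg (T.iterate_φ_pos false hP n) false)
  rw [Function.comp_apply, ENNReal.toReal_ofReal h2]
  simp [cost, actionValue]

theorem tendsto_thresholdWork_top {P : ℝ} (hP : 0 < P) :
    Filter.Tendsto (fun z : ℝ => T.thresholdWork P z) Filter.atTop
      (nhds (T.thresholdWork P ⊤)) := by
  rw [← tendsto_sub_nhds_zero_iff]
  refine tendsto_zero_of_discounted (T := T)
    (E := fun P z => T.thresholdWork P z - T.thresholdWork P ⊤) (b := fun _ => 1 / (1 - T.β))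
    (fun P _ z hz => ?_) (fun P _ z _ => ?_) hP ?_
  · rw [T.thresholdWork_of_le (EReal.coe_le_coe_iff.2 hz), T.thresholdWork_of_le le_top]
    ring
  · have h1 := T.thresholdWork_nonneg P z
    have h2 := T.thresholdWork_nonneg P ⊤
    have h3 := T.thresholdWork_le P z
    have h4 := T.thresholdWork_le P ⊤
    rw [abs_le]
    constructor <;> linarith
  · simpa using (tendsto_pow_atTop_nhds_zero_of_lt_one T.β_pos.le T.β_lt_one).mul_const
      (1 / (1 - T.β))

namespace PCLIndexable

variable (hT : T.PCLIndexable)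

include hT

theorem thresholdCost_le {l : ℝ} {P z : ℝ} (hP : 0 < P) (hz : 0 ≤ z) (hl : T.mpExt z ≤ l) :
    T.thresholdCost P z ≤ T.thresholdCost P 0 + |l| / (1 - T.β) := by
  have hβ : 0 < 1 - T.β := by linarith [T.β_lt_one]
  have hs : 0 ≤ |l| / (1 - T.β) := div_nonneg (abs_nonneg l) hβ.le
  rcases hz.eq_or_lt with h | h
  · rw [← h, EReal.coe_zero]
    linarith
  have h1 := (hT.thresholdCost_sub_bounds hP le_rfl h).2
  have h2 := hT.thresholdWork_antitone_coe hP hz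
  have h3 := T.thresholdWork_le P ((0 : ℝ) : EReal)
  have h4 := T.thresholdWork_nonneg P (z : EReal)
  simp only at h2
  have h5 : T.mpExt z * (T.thresholdWork P ((0 : ℝ) : EReal) - T.thresholdWork P z) ≤
      |l| * (1 / (1 - T.β)) :=
    mul_le_mul (hl.trans (le_abs_self l)) (by linarith) (by linarith) (abs_nonneg l)
  rw [mul_one_div] at h5
  rw [EReal.coe_zero] at h1 h5
  linarith

theorem costMetric_zero_ne_top {P : ℝ} (hP : 0 < P) : T.costMetric P (.threshold 0) ≠ ∞ := by
  simpa using hT.costMetric_ne_top hP 0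

/-- `F(P, ∞)` is the limit of the costs on finite horizons, on which the policies with large finite
thresholds do not track either. -/
theorem costMetric_top_le {l : ℝ} (hl : ∀ z, 0 ≤ z → T.mpExt z ≤ l) {P : ℝ} (hP : 0 < P) :
    T.costMetric P (.threshold ⊤) ≤
      ENNReal.ofReal (T.thresholdCost P 0 + |l| / (1 - T.β)) := by
  rw [T.costMetric_threshold_top]
  refine ENNReal.tsum_le_of_sum_range_le fun n => ?_
  obtain ⟨z, hz⟩ := ((Finset.range n).image fun t => (T.φ false)^[t] P).exists_le
  have hz' : ∀ t < n, (T.φ false)^[t] P ≤ max z 0 := fun t ht =>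
    (hz _ (Finset.mem_image_of_mem _ (Finset.mem_range.2 ht))).trans (le_max_left _ _)
  refine (T.sum_le_costMetric_threshold n hz').trans ?_
  rw [← ENNReal.ofReal_toReal (hT.costMetric_ne_top hP (max z 0))]
  exact ENNReal.ofReal_le_ofReal
    (hT.thresholdCost_le hP (le_max_right _ _) (hl _ (le_max_right _ _)))

theorem thresholdCost_top_le {l : ℝ} (hl : ∀ z, 0 ≤ z → T.mpExt z ≤ l) {P : ℝ} (hP : 0 < P) :
    T.thresholdCost P ⊤ ≤ T.thresholdCost P 0 + |l| / (1 - T.β) := by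
  have hβ : 0 < 1 - T.β := by linarith [T.β_lt_one]
  exact ENNReal.toReal_le_of_le_ofReal
    (add_nonneg ENNReal.toReal_nonneg (div_nonneg (abs_nonneg l) hβ.le)) (hT.costMetric_top_le hl hP)

theorem costMetric_top_ne_top {l : ℝ} (hl : ∀ z, 0 ≤ z → T.mpExt z ≤ l) {P : ℝ} (hP : 0 < P) :
    T.costMetric P (.threshold ⊤) ≠ ∞ :=
  ne_top_of_le_ne_top ENNReal.ofReal_ne_top (hT.costMetric_top_le hl hP)

/-- A bounded index makes `F(P, ∞)` finite and the limit of `F(P, z)`. -/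
theorem tendsto_thresholdCost_top {l : ℝ} (hl : ∀ z, 0 ≤ z → T.mpExt z ≤ l) {P : ℝ} (hP : 0 < P) :
    Filter.Tendsto (fun z : ℝ => T.thresholdCost P z) Filter.atTop
      (nhds (T.thresholdCost P ⊤)) := by
  obtain ⟨K, hK, hKle⟩ := T.exists_thresholdCost_zero_le fun P hP => hT.costMetric_zero_ne_top hP
  rw [← tendsto_sub_nhds_zero_iff]
  set s := |l| / (1 - T.β)
  refine tendsto_zero_of_discounted (T := T)
    (E := fun P z => T.thresholdCost P z - T.thresholdCost P ⊤)
    (b := fun P => K + s + K * (T.d * P)) (fun P hP z hz => ?_) (fun P hP z hz => ?_) hP ?_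
  · have hφ := T.φ_pos false hP
    rw [T.thresholdCost_of_le hP (EReal.coe_le_coe_iff.2 hz) (hT.costMetric_ne_top hφ z),
      T.thresholdCost_of_le hP le_top (hT.costMetric_top_ne_top hl hφ)]
    ring
  · have h1 : 0 ≤ T.thresholdCost P z := ENNReal.toReal_nonneg
    have h2 : 0 ≤ T.thresholdCost P ⊤ := ENNReal.toReal_nonneg
    have h3 := hT.thresholdCost_le hP hz (hl z hz)
    have h4 := hT.thresholdCost_top_le hl hP
    have h5 := hKle P hP
    rw [abs_le]
    constructor <;> linarith
  · have h1 := (tendsto_pow_atTop_nhds_zero_of_lt_one T.β_pos.le T.β_lt_one).mul_const (K + s)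
    have h2 := (tendsto_untracked_discounted hP (hT.costMetric_top_ne_top hl hP)).mul_const K
    have h3 := h1.add h2
    simp only [zero_mul, add_zero] at h3
    exact h3.congr fun n => by ring

/-- When the price exceeds all values of the index, never tracking is strictly better than
tracking once. -/
theorem marginalCost_top_lt {l : ℝ} (hl : ∀ z, 0 ≤ z → T.mpExt z < l) {P : ℝ} (hP : 0 < P) :
    T.marginalCost P ⊤ - l * T.marginalWork P ⊤ < 0 := by
  have hl' : ∀ z, 0 ≤ z → T.mpExt z ≤ l := fun z hz => (hl z hz).le
  have hw : Filter.Tendsto (fun z : ℝ => T.marginalWork P z) Filter.atTop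
      (nhds (T.marginalWork P ⊤)) := by
    simp only [marginalWork_eq]
    exact (((tendsto_thresholdWork_top (T.φ_pos true hP)).sub
      (tendsto_thresholdWork_top (T.φ_pos false hP))).const_mul T.β).const_add 1
  have hc : Filter.Tendsto (fun z : ℝ => T.marginalCost P z) Filter.atTop
      (nhds (T.marginalCost P ⊤)) := by
    rw [T.marginalCost_eq (fun P hP => hT.costMetric_top_ne_top hl' hP) hP]
    refine Filter.Tendsto.congr (fun z => (T.marginalCost_eq
      (fun P hP => hT.costMetric_ne_top hP z) hP).symm) ?_
    exact (((hT.tendsto_thresholdCost_top hl' (T.φ_pos false hP)).sub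
      (hT.tendsto_thresholdCost_top hl' (T.φ_pos true hP))).const_mul T.β).const_add (-T.h)
  have hlim := hc.sub (hw.const_mul l)
  have hgap : ∀ z : ℝ, T.marginalCost P z - l * T.marginalWork P z =
      T.gap P z + (T.mpExt z - l) * T.marginalWork P z := fun z => by
    unfold gap
    ring
  by_cases h : ∃ y, P < y ∧ T.mpIndex P < T.mpExt y
  · obtain ⟨y, hy, hPy⟩ := h
    refine (le_of_tendsto hlim ?_).trans_lt (hT.gap_neg hP (hP.trans hy).le hPy)
    filter_upwards [Filter.eventually_ge_atTop y] with z hz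
    have hz0 := (hP.trans hy).le.trans hz
    have h1 := (hT.gap_antitone hP (hP.trans hy).le hz).1
    have h2 := mul_nonneg (sub_nonneg.2 (hl' z hz0)) (hT.work_pos P hP z).le
    rw [hgap]
    linarith
  · -- The index is constant on `[P, ∞)`.
    push Not at h
    have heq : ∀ᶠ z : ℝ in Filter.atTop, (T.mpIndex P - l) * T.marginalWork P z =
        T.marginalCost P z - l * T.marginalWork P z := by
      filter_upwards [Filter.eventually_gt_atTop P] with z hz
      have h1 : T.mpExt z = T.mpIndex P := le_antisymm (h z hz)
        (mpExt_of_pos (T := T) hP ▸ hT.mpExt_monotoneOn hP.le (hP.trans hz).le hz.le)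
      rw [hgap, hT.gap_eq_zero hP (hP.trans hz).le h1, h1, zero_add]
    have h2 := tendsto_nhds_unique ((hw.const_mul (T.mpIndex P - l)).congr' heq) hlim
    rw [← h2]
    have h3 := hl P hP.le
    rw [mpExt_of_pos hP] at h3
    exact mul_neg_of_neg_of_pos (by linarith) (hT.work_pos P hP ⊤)

end PCLIndexable

/-! ### Optimal thresholds -/

/-- The `z`-threshold policy has finite costs of at most linear growth, and for the price `l` it
takes in each state an action singled out by the sign of `mp*(P) - l`, which is also the sign of
the advantage of tracking over not tracking once. -/
structure OptimalThreshold (T : SmartTarget M) (l : ℝ) (z : EReal) : Prop where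
  cost_ne_top : ∀ P, 0 < P → T.costMetric P (.threshold z) ≠ ∞
  growth : ∃ K, 0 ≤ K ∧ ∀ P, 0 < P → T.thresholdCost P z ≤ K + K * (T.d * P)
  le_of_lt : ∀ P : ℝ, 0 < P → z < P → l ≤ T.mpIndex P
  le_of_le : ∀ P : ℝ, 0 < P → P ≤ z → T.mpIndex P ≤ l
  pos : ∀ P, 0 < P → l < T.mpIndex P → 0 < T.marginalCost P z - l * T.marginalWork P z
  zero : ∀ P, 0 < P → l = T.mpIndex P → T.marginalCost P z - l * T.marginalWork P z = 0
  neg : ∀ P, 0 < P → T.mpIndex P < l → T.marginalCost P z - l * T.marginalWork P z < 0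

/-- For a price in the closure of the range of the index an optimal threshold is found by the
intermediate value theorem; for lower prices it is `0`, for higher ones `∞`. -/
theorem PCLIndexable.exists_optimalThreshold (hT : T.PCLIndexable) (l : ℝ) :
    ∃ z, T.OptimalThreshold l z := by
  have hβ : 0 < 1 - T.β := by linarith [T.β_lt_one]
  have hs : 0 ≤ |l| / (1 - T.β) := div_nonneg (abs_nonneg l) hβ.le
  obtain ⟨K, hK, hKle⟩ := T.exists_thresholdCost_zero_le fun P hP => hT.costMetric_zero_ne_top hP
  have hgrow : ∀ z : EReal, (∀ P, 0 < P →
      T.thresholdCost P z ≤ T.thresholdCost P 0 + |l| / (1 - T.β)) →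
      ∃ K, 0 ≤ K ∧ ∀ P, 0 < P → T.thresholdCost P z ≤ K + K * (T.d * P) := by
    intro z hz
    refine ⟨K + |l| / (1 - T.β), by positivity, fun P hP => ?_⟩
    have h1 := hz P hP
    have h2 := hKle P hP
    have h3 := mul_nonneg hs (mul_nonneg T.d_nonneg hP.le)
    linarith
  by_cases h : ∃ z, 0 ≤ z ∧ T.mpExt z = l
  · obtain ⟨z, hz, rfl⟩ := h
    refine ⟨(z : EReal), fun P hP => hT.costMetric_ne_top hP z,
      hgrow z fun P hP => hT.thresholdCost_le hP hz le_rfl, fun P hP h => ?_, fun P hP h => ?_,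
      fun P hP h => hT.gap_pos hP hz h, fun P hP h => hT.gap_eq_zero hP hz h,
      fun P hP h => hT.gap_neg hP hz h⟩
    · rw [← mpExt_of_pos hP]
      exact hT.mpExt_monotoneOn hz hP.le (EReal.coe_lt_coe_iff.1 h).le
    · rw [← mpExt_of_pos hP]
      exact hT.mpExt_monotoneOn hP.le hz (EReal.coe_le_coe_iff.1 h)
  rcases lt_or_ge l (T.mpExt 0) with h0 | h0
  · have hlt : ∀ P, 0 < P → l < T.mpIndex P := fun P hP => by
      rw [← mpExt_of_pos hP]
      exact h0.trans_le (hT.mpExt_monotoneOn self_mem_Ici hP.le hP.le)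
    refine ⟨0, fun P hP => hT.costMetric_zero_ne_top hP, ⟨K, hK, hKle⟩,
      fun P hP _ => (hlt P hP).le, fun P hP h => ?_, fun P hP _ => ?_,
      fun P hP h => absurd h (hlt P hP).ne, fun P hP h => absurd h (hlt P hP).not_gt⟩
    · exact absurd (EReal.coe_nonpos.1 h) hP.not_ge
    · have h1 := (hT.gap_antitone hP le_rfl hP.le).1
      rw [hT.gap_self hP] at h1
      have h2 := mul_pos (sub_pos.2 h0) (hT.work_pos P hP 0)
      unfold gap at h1
      rw [EReal.coe_zero] at h1
      linarith
  · have hlt : ∀ z, 0 ≤ z → T.mpExt z < l := by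
      intro z hz
      by_contra! hle
      obtain ⟨y, hy, hyl⟩ := intermediate_value_Icc hz
        (hT.mpExt_continuousOn.mono Icc_subset_Ici_self) ⟨h0, hle⟩
      exact h ⟨y, hy.1, hyl⟩
    have hlt' : ∀ P, 0 < P → T.mpIndex P < l := fun P hP => mpExt_of_pos (T := T) hP ▸ hlt P hP.le
    have hle : ∀ z, 0 ≤ z → T.mpExt z ≤ l := fun z hz => (hlt z hz).le
    exact ⟨⊤, fun P hP => hT.costMetric_top_ne_top hle hP,
      hgrow ⊤ fun P hP => hT.thresholdCost_top_le hle hP, fun P _ h => absurd h not_top_lt,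
      fun P hP _ => (hlt' P hP).le, fun P hP h => absurd h (hlt' P hP).not_gt,
      fun P hP h => absurd h (hlt' P hP).ne', fun P hP _ => hT.marginalCost_top_lt hlt hP⟩

/-- Objective of the `z`-threshold policy, as a real number. -/
noncomputable def thresholdValue (T : SmartTarget M) (l : ℝ) (z : EReal) (P : ℝ) : ℝ :=
  T.thresholdCost P z + l * T.thresholdWork P z

/-- Objective of taking action `a` at time `0` and following the `z`-threshold policy from time `1`
onwards. -/
noncomputable def actionValueAt (T : SmartTarget M) (l : ℝ) (z : EReal) (P : ℝ) (a : Bool) : ℝ :=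
  T.cost P a + l * actionValue a + T.β * T.thresholdValue l z (T.φ a P)

theorem objective_startWith (l : ℝ) {P : ℝ} (hP : 0 < P) (a : Bool) {π : TrackingPolicy}
    (h : T.costMetric (T.φ a P) π ≠ ∞) :
    T.objective l P (.startWith a π) =
      ((T.cost P a + l * actionValue a + T.β * ((T.costMetric (T.φ a P) π).toReal +
        l * T.workMetric (T.φ a P) π) : ℝ) : EReal) := by
  rw [T.objective_of_ne_top l P ((T.costMetric_startWith_ne_top_iff P a π).2 h),
    T.costMetric_startWith_toReal hP a h, T.workMetric_startWith]
  congr 1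
  ring

namespace OptimalThreshold

variable {l : ℝ} {z : EReal} (hz : T.OptimalThreshold l z)

include hz

theorem objective_eq {P : ℝ} (hP : 0 < P) :
    T.objective l P (.threshold z) = T.thresholdValue l z P :=
  T.objective_of_ne_top l P (hz.cost_ne_top P hP)

open Classical in
theorem thresholdValue_eq {P : ℝ} (hP : 0 < P) :
    T.thresholdValue l z P = T.actionValueAt l z P (decide (z < (P : EReal))) := by
  have h := hz.cost_ne_top _ (T.φ_pos (decide (z < (P : EReal))) hP)
  unfold thresholdValue actionValueAt thresholdCost thresholdWork
  rw [costMetric_threshold, workMetric_threshold, T.costMetric_startWith_toReal hP _ h,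
    workMetric_startWith]
  unfold thresholdValue thresholdCost thresholdWork
  ring

theorem actionValueAt_sub {P : ℝ} (hP : 0 < P) :
    T.actionValueAt l z P false - T.actionValueAt l z P true =
      T.marginalCost P z - l * T.marginalWork P z := by
  rw [T.marginalCost_eq hz.cost_ne_top hP, T.marginalWork_eq]
  unfold actionValueAt thresholdValue
  simp [cost, actionValue]
  ring

theorem actionValueAt_true_le_iff {P : ℝ} (hP : 0 < P) :
    T.actionValueAt l z P true ≤ T.actionValueAt l z P false ↔ l ≤ T.mpIndex P := by
  have h := hz.actionValueAt_sub hP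
  rcases lt_trichotomy l (T.mpIndex P) with h1 | h1 | h1
  · have := hz.pos P hP h1
    exact iff_of_true (by linarith) h1.le
  · have := hz.zero P hP h1
    exact iff_of_true (by linarith) h1.le
  · have := hz.neg P hP h1
    exact iff_of_false (by linarith) h1.not_ge

theorem actionValueAt_false_le_iff {P : ℝ} (hP : 0 < P) :
    T.actionValueAt l z P false ≤ T.actionValueAt l z P true ↔ T.mpIndex P ≤ l := by
  have h := hz.actionValueAt_sub hP
  rcases lt_trichotomy l (T.mpIndex P) with h1 | h1 | h1
  · have := hz.pos P hP h1
    exact iff_of_false (by linarith) h1.not_ge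
  · have := hz.zero P hP h1
    exact iff_of_true (by linarith) h1.ge
  · have := hz.neg P hP h1
    exact iff_of_true (by linarith) h1.le

/-- One half of the Bellman equation; `thresholdValue_eq` says that one of the two actions gives
equality. -/
theorem thresholdValue_le {P : ℝ} (hP : 0 < P) (a : Bool) :
    T.thresholdValue l z P ≤ T.actionValueAt l z P a := by
  rw [hz.thresholdValue_eq hP]
  rcases lt_or_ge z (P : EReal) with h | h
  · rw [decide_eq_true h]
    have := (hz.actionValueAt_true_le_iff hP).2 (hz.le_of_lt P hP h)
    cases a
    · exact this
    · exact le_rfl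
  · rw [decide_eq_false h.not_gt]
    have := (hz.actionValueAt_false_le_iff hP).2 (hz.le_of_le P hP h)
    cases a
    · exact le_rfl
    · exact this

theorem thresholdValue_le_objective {P : ℝ} (hP : 0 < P) (π : TrackingPolicy) :
    (T.thresholdValue l z P : EReal) ≤ T.objective l P π := by
  obtain ⟨K, hK, hle⟩ := hz.growth
  have hβ : 0 < 1 - T.β := by linarith [T.β_lt_one]
  have hs : 0 ≤ |l| / (1 - T.β) := div_nonneg (abs_nonneg l) hβ.le
  refine T.le_objective_of_bellman (K := K + |l| / (1 - T.β)) (by positivity)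
    (fun P hP a => hz.thresholdValue_le hP a) (fun P hP => ?_) hP π
  have h1 := hle P hP
  have h2 := mul_nonneg hs (mul_nonneg T.d_nonneg hP.le)
  have h3 : l * T.thresholdWork P z ≤ |l| * (1 / (1 - T.β)) :=
    mul_le_mul (le_abs_self l) (T.thresholdWork_le P z) (T.thresholdWork_nonneg P z) (abs_nonneg l)
  rw [mul_one_div] at h3
  unfold thresholdValue
  linarith

/-- Action `a` is optimal if and only if it attains the minimum in the Bellman equation. -/
theorem actionOptimal_iff {P : ℝ} (hP : 0 < P) (a : Bool) :
    T.ActionOptimal l P a ↔ T.actionValueAt l z P a ≤ T.thresholdValue l z P := by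
  constructor
  · rintro ⟨π, -, h⟩
    have h1 := h _ (TrackingPolicy.isStationary_threshold z)
    rw [hz.objective_eq hP] at h1
    have hfin : T.costMetric (T.φ a P) π ≠ ∞ := by
      rw [← T.costMetric_startWith_ne_top_iff P a π]
      intro htop
      rw [T.objective_of_eq_top l P htop] at h1
      exact absurd h1 (EReal.coe_lt_top _).not_ge
    have h2 := hz.thresholdValue_le_objective (T.φ_pos a hP) π
    rw [T.objective_of_ne_top l _ hfin, EReal.coe_le_coe_iff] at h2
    rw [objective_startWith l hP a hfin, EReal.coe_le_coe_iff] at h1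
    have h3 := mul_le_mul_of_nonneg_left h2 T.β_pos.le
    unfold actionValueAt
    linarith
  · intro h
    refine ⟨_, TrackingPolicy.isStationary_threshold z, fun π' _ => ?_⟩
    refine le_trans ?_ (hz.thresholdValue_le_objective hP π')
    rw [objective_startWith l hP a (hz.cost_ne_top _ (T.φ_pos a hP)), EReal.coe_le_coe_iff]
    exact h

theorem actionOptimal_iff_forall {P : ℝ} (hP : 0 < P) (a : Bool) :
    T.ActionOptimal l P a ↔ T.actionValueAt l z P a ≤ T.actionValueAt l z P (!a) := by
  rw [hz.actionOptimal_iff hP]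
  refine ⟨fun h => h.trans (hz.thresholdValue_le hP _), fun h => ?_⟩
  rw [hz.thresholdValue_eq hP]
  rcases Bool.eq_or_eq_not (decide (z < (P : EReal))) a with h1 | h1
  · rw [h1]
  · rw [h1]
    exact h

end OptimalThreshold

end SmartTarget

theorem corollary1 {M : ℕ} (T : SmartTarget M) (hT : T.PCLIndexable) :
    T.Indexable ∧ T.IsWhittleIndex T.mpIndex := by
  have h : T.IsWhittleIndex T.mpIndex := by
    intro l P hP
    obtain ⟨z, hz⟩ := hT.exists_optimalThreshold l
    rw [hz.actionOptimal_iff_forall hP, hz.actionOptimal_iff_forall hP]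
    exact ⟨hz.actionValueAt_true_le_iff hP, hz.actionValueAt_false_le_iff hP⟩
  exact ⟨⟨_, h⟩, h⟩
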